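/- \textbf{Theorem (Asymptotic normality of the Dirichlet kernel estimator).} Let $d\ge 1$, $\|s\|_1=\sum_{i=1}^d|s_i|$, $\mathcal S=\{s\in[0,1]^d:\|s\|_1\le 1\}$ and $\mathrm{Int}(\mathcal S)=\{s\in(0,1)^d:\|s\|_1<1\}$. For $\alpha_1,\dots,\alpha_d,\beta>0$ let $$K_{\alpha,\beta}(x)=\frac{\Gamma(\|\alpha\|_1+\beta)}{\Gamma(\beta)\prod_{i=1}^d\Gamma(\alpha_i)}\,(1-\|x\|_1)^{\beta-1}\prod_{i=1}^d x_i^{\alpha_i-1},\qquad x\in\mathcal S,$$ be the Dirichlet density. Let $X_1,X_2,\dots$ be i.i.d. random vectors with a density $f$ (with respect to Lebesgue measure) supported on $\mathcal S$, and for $b>0$, $n\ge 1$, $s\in\mathcal S$ put $$\hat f_{n,b}(s)=\frac1n\sum_{i=1}^nK_{s/b+1,\,(1-\|s\|_1)/b+1}(X_i),\qquad f_b(s)=\mathbb E\big[\hat f_{n,b}(s)\big].$$ Write $$\psi(s)=\Big[(4\pi)^d(1-\|s\|_1)\prod_{i=1}^ds_i\Big]^{-1/2}$$ and, when $f$ is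 $C^2$, $$g(s)=\sum_{i=1}^d(1-(d+1)s_i)\frac{\partial f}{\partial s_i}(s)+\frac12\sum_{i,j=1}^ds_i(\mathbf 1_{\{i=j\}}-s_j)\frac{\partial^2f}{\partial s_i\partial s_j}(s).$$ Let $s\in\mathrm{Int}(\mathcal S)$ with $f(s)>0$, and let $b=b(n)>0$ be a sequence of bandwidths. All limits are taken as $n\to\infty$, and $\xrightarrow{\mathscr D}$ is convergence in law. (i) If $f$ is Lipschitz continuous on $\mathcal S$, $b\to0$ and $n^{1/2}b^{d/4}\to\infty$, then $$n^{1/2}b^{d/4}\big(\hat f_{n,b}(s)-f_b(s)\big)\xrightarrow{\mathscr D}\mathcal N\big(0,\psi(s)f(s)\big).$$ (ii) If, in addition to the assumptions of (i), $n^{1/2}b^{d/4+1/2}\to0$, then $$n^{1/2}b^{d/4}\big(\hat f_{n,b}(s)-f(s)\big)\xrightarrow{\mathscr D}\mathcal N\big(0,\psi(s)f(s)\big).$$ (iii) Independently of the rates in (i) and (ii), if $f$ is twice continuously differentiable on $\mathcal S$ and $n^{2/(d+4)}b\to\lambda$ for some $\lambda>0$, then $$n^{2/(d+4)}\big(\hat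 f_{n,b}(s)-f(s)\big)\xrightarrow{\mathscr D}\mathcal N\big(\lambda g(s),\lambda^{-d/2}\psi(s)f(s)\big).$$ -/

import Mathlib

open MeasureTheory ProbabilityTheory Filter Topology

namespace DirichletKernel

noncomputable section

/-- The norm `‖s‖₁ = ∑ |sᵢ|` of a vector of `ℝᵈ`. -/
def l1Norm {d : ℕ} (s : Fin d → ℝ) : ℝ := ∑ i, |s i|

/-- The simplex `{s ∈ [0,1]ᵈ : ‖s‖₁ ≤ 1}`. -/
def simplex (d : ℕ) : Set (Fin d → ℝ) :=
  {s | (∀ i, s i ∈ Set.Icc (0 : ℝ) 1) ∧ l1Norm s ≤ 1}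

/-- The interior of the simplex, `{s ∈ (0,1)ᵈ : ‖s‖₁ < 1}`. -/
def simplexInterior (d : ℕ) : Set (Fin d → ℝ) :=
  {s | (∀ i, s i ∈ Set.Ioo (0 : ℝ) 1) ∧ l1Norm s < 1}

/-- The density `K_{α,β}` of the Dirichlet distribution with parameters `α₁, …, α_d, β > 0`, as a
function on the simplex (its values elsewhere play no role). -/
def dirichletDensity {d : ℕ} (α : Fin d → ℝ) (β : ℝ) (x : Fin d → ℝ) : ℝ :=
  Real.Gamma (l1Norm α + β) / (Real.Gamma β * ∏ i, Real.Gamma (α i)) *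
    ((1 - l1Norm x) ^ (β - 1) * ∏ i, x i ^ (α i - 1))

/-- The Dirichlet kernel at `s` with bandwidth `b`: the density `K_{s/b+1, (1-‖s‖₁)/b+1}`. -/
def kernel {d : ℕ} (b : ℝ) (s x : Fin d → ℝ) : ℝ :=
  dirichletDensity (fun i => s i / b + 1) ((1 - l1Norm s) / b + 1) x

/-- The Dirichlet kernel estimator `f̂_{n,b}(s)`, built from the first `n` observations of the
sequence `X 0, X 1, …`, as a random variable. -/
def estimator {d : ℕ} {Ω : Type*} (X : ℕ → Ω → Fin d → ℝ) (n : ℕ) (b : ℝ) (s : Fin d → ℝ)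
    (ω : Ω) : ℝ :=
  1 / (n : ℝ) * ∑ i ∈ Finset.range n, kernel b s (X i ω)

/-- The probability law on `ℝᵈ` carried by the simplex and having density `f` there. -/
def lawOfDensity {d : ℕ} (f : (Fin d → ℝ) → ℝ) : Measure (Fin d → ℝ) :=
  (volume.restrict (simplex d)).withDensity fun x => ENNReal.ofReal (f x)

/-- The function `ψ(s) = ((4π)ᵈ (1 - ‖s‖₁) ∏ sᵢ)^(-1/2)`. -/
def psi {d : ℕ} (s : Fin d → ℝ) : ℝ :=
  ((4 * Real.pi) ^ d * (1 - l1Norm s) * ∏ i, s i) ^ (-(1 / 2) : ℝ)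

/-- The partial derivative `∂f/∂sᵢ` on the simplex. In the interior this is the ordinary partial
derivative. -/
def partialDeriv {d : ℕ} (i : Fin d) (f : (Fin d → ℝ) → ℝ) (s : Fin d → ℝ) : ℝ :=
  fderivWithin ℝ f (simplex d) s (Pi.single i 1)

/-- The function
`g(s) = ∑ᵢ (1 - (d+1) sᵢ) ∂ᵢf(s) + ½ ∑ᵢⱼ sᵢ (1_{i=j} - sⱼ) ∂ᵢ∂ⱼf(s)`. -/
def biasTerm {d : ℕ} (f : (Fin d → ℝ) → ℝ) (s : Fin d → ℝ) : ℝ :=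
  ∑ i, (1 - ((d : ℝ) + 1) * s i) * partialDeriv i f s +
    1 / 2 * ∑ i, ∑ j, s i * ((if i = j then 1 else 0) - s j) *
      partialDeriv i (partialDeriv j f) s

end

end DirichletKernel

/-!
The square of the kernel is again a kernel, `K_b² = A_b(s) K_{b/2}`, and the Gamma ratios in
`A_b(s)` give `b^(d/2) A_b(s) → ψ(s)` as `b → 0`. Since the Dirichlet laws with density `K_b`
concentrate at `s`, an observation `X` has `b^(d/2) E[K_b(X)²] → ψ(s) f(s)`, and squaring once
more shows `b^(3d/2) E[K_b(X)⁴]` to be bounded. These are the variance and the Lyapunov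
condition in a central limit theorem for triangular arrays, because `n b^(d/2) → ∞`.

For the bias, `E[K_b(X)]` is the mean of `f` under the Dirichlet law with density `K_b`. Stein's
identity for Dirichlet laws, `E[((∑ⱼ αⱼ + β) Yᵢ - αᵢ) p(Y)] = E[Yᵢ (∂ᵢp - ∑ⱼ Yⱼ ∂ⱼp)(Y)]`, gives
the first order term in `b` of its moments, hence of the mean of a second order Taylor expansion
of `f` at `s`.
-/

namespace DirichletKernel

/-! ### A Lyapunov central limit theorem for triangular arrays -/

lemma norm_cexp_mul_I_sub_taylor_le (u : ℝ) :
    ‖Complex.exp (u * Complex.I) - (1 + u * Complex.I - u ^ 2 / 2)‖ ≤ 4 * |u| ^ 3 := by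
  rcases le_total |u| 1 with hu | hu
  · have taylor : ∑ m ∈ Finset.range 3, (u * Complex.I) ^ m / (m.factorial : ℂ) =
        1 + u * Complex.I - u ^ 2 / 2 := by
      simp [Finset.sum_range_succ, Nat.factorial, mul_pow]
      ring
    have h := Complex.exp_bound (x := u * Complex.I) (by simpa using hu) (n := 3) (by norm_num)
    rw [taylor, norm_mul, Complex.norm_I, mul_one, Complex.norm_real, Real.norm_eq_abs] at h
    refine h.trans ?_
    rw [mul_comm]
    gcongr
    norm_num [Nat.factorial]
  · calc _ ≤ ‖Complex.exp (u * Complex.I)‖ + (‖(1 : ℂ)‖ + ‖(u : ℂ) * Complex.I‖ +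
          ‖(u : ℂ) ^ 2 / 2‖) :=
        (norm_sub_le _ _).trans (by
          gcongr
          exact (norm_sub_le _ _).trans (by gcongr; exact norm_add_le _ _))
      _ = 1 + (1 + |u| + |u| ^ 2 / 2) := by simp [Complex.norm_exp_ofReal_mul_I]
      _ ≤ 4 * |u| ^ 3 := by
        have h2 : |u| ≤ |u| ^ 3 := le_self_pow₀ hu (by norm_num)
        have h3 : |u| ^ 2 ≤ |u| ^ 3 := pow_le_pow_right₀ hu (by norm_num)
        linarith

lemma integrable_pow_of_memLp {E : Type*} [MeasurableSpace E] {μ : Measure E} [IsFiniteMeasure μ]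
    {g : E → ℝ} {p k : ℕ} (h : MemLp g p μ) (hk : k ≤ p) : Integrable (fun x => g x ^ k) μ :=
  (((h.mono_exponent (by exact_mod_cast hk)).integrable_norm_pow').mono
    (h.aestronglyMeasurable.pow k) (ae_of_all _ fun x => by simp))

lemma sq_integral_abs_cube_le {μ : Measure ℝ} [IsFiniteMeasure μ] (h : MemLp id (4 : ℕ) μ) :
    (∫ x, |x| ^ 3 ∂μ) ^ 2 ≤ (∫ x, x ^ 2 ∂μ) * ∫ x, x ^ 4 ∂μ := by
  have int_sq : Integrable (fun x : ℝ => x ^ 2) μ := integrable_pow_of_memLp h (by norm_num)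
  have int_four : Integrable (fun x : ℝ => x ^ 4) μ := integrable_pow_of_memLp h le_rfl
  have int_cube : Integrable (fun x : ℝ => |x| ^ 3) μ :=
    integrable_pow_of_memLp (p := 4) h.abs (by norm_num)
  have nonneg (t : ℝ) : 0 ≤ (∫ x, x ^ 2 ∂μ) * (t * t) + (-2 * ∫ x, |x| ^ 3 ∂μ) * t +
      ∫ x, x ^ 4 ∂μ := by
    calc 0 ≤ ∫ x, (t * |x| - x ^ 2) ^ 2 ∂μ := integral_nonneg fun x => sq_nonneg _
      _ = ∫ x, (t * t * x ^ 2 - 2 * t * |x| ^ 3 + x ^ 4) ∂μ := by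
        congr 1 with x
        rw [← sq_abs x, ← Even.pow_abs (n := 4) (by decide) x]
        ring
      _ = _ := by
        have int_quad := int_sq.const_mul (t * t)
        have int_cubic := int_cube.const_mul (2 * t)
        rw [integral_add (by exact int_quad.sub int_cubic) int_four,
          integral_sub int_quad int_cubic, integral_const_mul, integral_const_mul]
        ring
  linarith [discrim_le_zero nonneg, show discrim (∫ x, x ^ 2 ∂μ) (-2 * ∫ x, |x| ^ 3 ∂μ)
    (∫ x, x ^ 4 ∂μ) = 4 * ((∫ x, |x| ^ 3 ∂μ) ^ 2 - (∫ x, x ^ 2 ∂μ) * ∫ x, x ^ 4 ∂μ) by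
      unfold discrim; ring]

lemma norm_charFun_sub_taylor_le {μ : Measure ℝ} [IsProbabilityMeasure μ]
    (h : MemLp id (3 : ℕ) μ) (t : ℝ) :
    ‖charFun μ t - (1 + t * (∫ x, x ∂μ : ℝ) * Complex.I - t ^ 2 / 2 * (∫ x, x ^ 2 ∂μ : ℝ))‖ ≤
      4 * |t| ^ 3 * ∫ x, |x| ^ 3 ∂μ := by
  have int_id : Integrable (fun x : ℝ => (x : ℂ)) μ :=
    (h.integrable (by norm_num)).ofReal
  have int_sq : Integrable (fun x : ℝ => ((x ^ 2 : ℝ) : ℂ)) μ :=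
    (integrable_pow_of_memLp h (by norm_num)).ofReal
  have int_cube : Integrable (fun x : ℝ => |x| ^ 3) μ :=
    integrable_pow_of_memLp (p := 3) h.abs le_rfl
  have int_exp : Integrable (fun x : ℝ => Complex.exp (t * x * Complex.I)) μ :=
    .of_bound (C := 1) (by fun_prop) (ae_of_all _ fun x => by
      rw [← Complex.ofReal_mul, Complex.norm_exp_ofReal_mul_I])
  have integral_taylor : charFun μ t -
      (1 + t * (∫ x, x ∂μ : ℝ) * Complex.I - t ^ 2 / 2 * (∫ x, x ^ 2 ∂μ : ℝ)) =
      ∫ x : ℝ, (Complex.exp (t * x * Complex.I) -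
        (1 + t * x * Complex.I - t ^ 2 / 2 * (x ^ 2 : ℝ))) ∂μ := by
    have int_linear := (int_id.const_mul (t : ℂ)).mul_const Complex.I
    have int_quad := int_sq.const_mul ((t : ℂ) ^ 2 / 2)
    have int_affine := (integrable_const (1 : ℂ)).add int_linear
    rw [integral_sub int_exp (by exact int_affine.sub int_quad),
      integral_sub (by exact int_affine) int_quad, integral_add (integrable_const 1) int_linear,
      integral_mul_const, integral_const_mul, integral_const_mul, integral_complex_ofReal,
      integral_complex_ofReal, charFun_apply_real]
    simp
  rw [integral_taylor, ← integral_const_mul]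
  refine norm_integral_le_of_norm_le (int_cube.const_mul _) (ae_of_all _ fun x => ?_)
  convert norm_cexp_mul_I_sub_taylor_le (t * x) using 1
  · push_cast
    ring_nf
  · rw [abs_mul]
    ring

lemma tendsto_charFun_pow {μ : ℕ → Measure ℝ} [∀ n, IsProbabilityMeasure (μ n)]
    (h4 : ∀ᶠ n in atTop, MemLp id (4 : ℕ) (μ n)) {m v : ℝ}
    (hm : Tendsto (fun n : ℕ => n * ∫ x, x ∂μ n) atTop (𝓝 m))
    (hv : Tendsto (fun n : ℕ => n * ∫ x, x ^ 2 ∂μ n) atTop (𝓝 v))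
    (hk : Tendsto (fun n : ℕ => n * ∫ x, x ^ 4 ∂μ n) atTop (𝓝 0)) (t : ℝ) :
    Tendsto (fun n => charFun (μ n) t ^ n) atTop
      (𝓝 (Complex.exp (t * m * Complex.I - t ^ 2 / 2 * v))) := by
  have cube : Tendsto (fun n : ℕ => n * ∫ x, |x| ^ 3 ∂μ n) atTop (𝓝 0) := by
    refine squeeze_zero' (g := fun n : ℕ => √((n * ∫ x, x ^ 2 ∂μ n) * (n * ∫ x, x ^ 4 ∂μ n)))
      (.of_forall fun n => mul_nonneg n.cast_nonneg (integral_nonneg fun x => by positivity))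
      ?_ (by simpa using (hv.mul hk).sqrt)
    filter_upwards [h4] with n h4
    refine Real.le_sqrt_of_sq_le ?_
    calc (n * ∫ x, |x| ^ 3 ∂μ n) ^ 2 = n ^ 2 * (∫ x, |x| ^ 3 ∂μ n) ^ 2 := mul_pow _ _ _
      _ ≤ n ^ 2 * ((∫ x, x ^ 2 ∂μ n) * ∫ x, x ^ 4 ∂μ n) := by
        gcongr
        exact sq_integral_abs_cube_le h4
      _ = _ := by ring
  have error : Tendsto (fun n : ℕ => (n : ℂ) * (charFun (μ n) t - (1 + t * (∫ x, x ∂μ n : ℝ) *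
      Complex.I - t ^ 2 / 2 * (∫ x, x ^ 2 ∂μ n : ℝ)))) atTop (𝓝 0) := by
    refine squeeze_zero_norm' (a := fun n : ℕ => 4 * |t| ^ 3 * (n * ∫ x, |x| ^ 3 ∂μ n)) ?_
      (by simpa using cube.const_mul (4 * |t| ^ 3))
    filter_upwards [h4] with n h4
    rw [norm_mul, Complex.norm_natCast, mul_left_comm]
    exact mul_le_mul_of_nonneg_left
      (norm_charFun_sub_taylor_le (h4.mono_exponent (by norm_num)) t) n.cast_nonneg
  have taylor : Tendsto (fun n : ℕ => t * (n * ∫ x, x ∂μ n : ℝ) * Complex.I -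
      t ^ 2 / 2 * (n * ∫ x, x ^ 2 ∂μ n : ℝ)) atTop
      (𝓝 (t * m * Complex.I - t ^ 2 / 2 * v : ℂ)) :=
    (((Complex.continuous_ofReal.tendsto m).comp hm).const_mul _ |>.mul_const _).sub
      (((Complex.continuous_ofReal.tendsto v).comp hv).const_mul _)
  have h := Complex.tendsto_one_add_pow_exp_of_tendsto (g := fun n => charFun (μ n) t - 1)
    ((error.add taylor).congr fun n => by push_cast; ring) |>.congr fun n => by
      rw [add_sub_cancel]
  rwa [zero_add] at h

theorem tendstoInDistribution_sum_of_iid_rows {Ω : Type*} [MeasurableSpace Ω] {P : Measure Ω}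
    [IsProbabilityMeasure P] {Y : ℕ → ℕ → Ω → ℝ} {μ : ℕ → Measure ℝ}
    (hindep : ∀ n, iIndepFun (Y n) P) (hlaw : ∀ n i, HasLaw (Y n i) (μ n) P)
    (h4 : ∀ᶠ n in atTop, MemLp id (4 : ℕ) (μ n)) {m v : ℝ}
    (hm : Tendsto (fun n : ℕ => n * ∫ x, x ∂μ n) atTop (𝓝 m))
    (hv : Tendsto (fun n : ℕ => n * ∫ x, x ^ 2 ∂μ n) atTop (𝓝 v))
    (hk : Tendsto (fun n : ℕ => n * ∫ x, x ^ 4 ∂μ n) atTop (𝓝 0)) :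
    TendstoInDistribution (fun n ω => ∑ i ∈ Finset.range n, Y n i ω) atTop (id : ℝ → ℝ)
      (fun _ => P) (gaussianReal m v.toNNReal) := by
  have v0 : 0 ≤ v := ge_of_tendsto' hv fun n =>
    mul_nonneg n.cast_nonneg (integral_nonneg fun x => by positivity)
  have prob (n) : IsProbabilityMeasure (μ n) := (hlaw n 0).isProbabilityMeasure_iff.1 ‹_›
  have meas (n i) : AEMeasurable (Y n i) P := (hlaw n i).aemeasurable
  refine ⟨fun n => Finset.aemeasurable_fun_sum _ fun i _ => meas n i, by fun_prop,
    ProbabilityMeasure.tendsto_iff_tendsto_charFun.2 fun t => ?_⟩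
  simp only [ProbabilityMeasure.coe_mk, Measure.map_id, charFun_gaussianReal]
  have charFun_sum (n) : charFun (P.map fun ω => ∑ i ∈ Finset.range n, Y n i ω) t =
      charFun (μ n) t ^ n := by
    rw [iIndepFun.charFun_map_fun_finsetSum_eq_prod (s := Finset.range n) (fun i _ => meas n i)
      ((hindep n).restrict _)]
    simp [(hlaw n _).map_eq]
  simp_rw [charFun_sum, Real.coe_toNNReal v v0]
  convert tendsto_charFun_pow h4 hm hv hk t using 3
  ring

/-! ### The Dirichlet distribution -/

variable {d : ℕ}

lemma l1Norm_of_nonneg {x : Fin d → ℝ} (h : ∀ i, 0 ≤ x i) : l1Norm x = ∑ i, x i :=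
  Finset.sum_congr rfl fun i _ => abs_of_nonneg (h i)

lemma mem_simplex_iff {x : Fin d → ℝ} : x ∈ simplex d ↔ (∀ i, 0 ≤ x i) ∧ ∑ i, x i ≤ 1 := by
  refine ⟨fun ⟨h, h1⟩ => ⟨fun i => (h i).1, by rwa [l1Norm_of_nonneg fun i => (h i).1] at h1⟩,
    fun ⟨h, h1⟩ => ⟨fun i => ⟨h i, ?_⟩, by rwa [l1Norm_of_nonneg h]⟩⟩
  exact (Finset.single_le_sum (fun j _ => h j) (Finset.mem_univ i)).trans h1

lemma simplexInterior_subset : simplexInterior d ⊆ simplex d := fun _ hx =>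
  ⟨fun i => Set.Ioo_subset_Icc_self (hx.1 i), hx.2.le⟩

@[fun_prop]
lemma continuous_l1Norm : Continuous (l1Norm (d := d)) := by
  unfold l1Norm
  fun_prop

lemma isOpen_simplexInterior : IsOpen (simplexInterior d) := by
  have : simplexInterior d = Set.univ.pi (fun _ => Set.Ioo 0 1) ∩ {x | l1Norm x < 1} := by
    ext x
    simp only [simplexInterior, Set.mem_ofPred_eq, Set.mem_inter_iff, Set.mem_univ_pi]
  rw [this]
  exact (isOpen_set_pi Set.finite_univ fun _ _ => isOpen_Ioo).inter
    (isOpen_lt continuous_l1Norm continuous_const)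

lemma simplex_mem_nhds {s : Fin d → ℝ} (hs : s ∈ simplexInterior d) : simplex d ∈ 𝓝 s :=
  mem_of_superset (isOpen_simplexInterior.mem_nhds hs) simplexInterior_subset

lemma isCompact_simplex : IsCompact (simplex d) := by
  have : simplex d = Set.univ.pi (fun _ => Set.Icc 0 1) ∩ {x | l1Norm x ≤ 1} := by
    ext x
    simp only [simplex, Set.mem_ofPred_eq, Set.mem_inter_iff, Set.mem_univ_pi]
  rw [this]
  exact (isCompact_univ_pi fun _ => isCompact_Icc).inter_right
    (isClosed_le continuous_l1Norm continuous_const)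

lemma measurableSet_simplex : MeasurableSet (simplex d) := isCompact_simplex.isClosed.measurableSet

/-- The multivariate Beta function `Γ(β) ∏ Γ(αᵢ) / Γ(∑ αᵢ + β)`, the normalising constant of the
Dirichlet density. -/
noncomputable def dirichletBeta (α : Fin d → ℝ) (β : ℝ) : ℝ :=
  Real.Gamma β * (∏ i, Real.Gamma (α i)) / Real.Gamma (∑ i, α i + β)

lemma sum_add_pos {α : Fin d → ℝ} {β : ℝ} (hα : ∀ i, 0 < α i) (hβ : 0 < β) : 0 < ∑ i, α i + β :=
  add_pos_of_nonneg_of_pos (Finset.sum_nonneg fun i _ => (hα i).le) hβ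

lemma dirichletBeta_pos {α : Fin d → ℝ} {β : ℝ} (hα : ∀ i, 0 < α i) (hβ : 0 < β) :
    0 < dirichletBeta α β :=
  div_pos (mul_pos (Real.Gamma_pos_of_pos hβ)
    (Finset.prod_pos fun i _ => Real.Gamma_pos_of_pos (hα i)))
    (Real.Gamma_pos_of_pos (sum_add_pos hα hβ))

lemma dirichletBeta_add_single {α : Fin d → ℝ} {β : ℝ} (hα : ∀ i, 0 < α i) (hβ : 0 < β)
    (i : Fin d) :
    (∑ j, α j + β) * dirichletBeta (α + Pi.single i 1) β = α i * dirichletBeta α β := by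
  have gamma_single (j) : Real.Gamma ((α + Pi.single i 1 : Fin d → ℝ) j) =
      (if j = i then α j else 1) * Real.Gamma (α j) := by
    rcases eq_or_ne j i with rfl | h
    · simp [Real.Gamma_add_one (hα j).ne']
    · simp [h]
  have gamma_prod : ∏ j, Real.Gamma ((α + Pi.single i 1 : Fin d → ℝ) j) =
      α i * ∏ j, Real.Gamma (α j) := by
    simp_rw [gamma_single, Finset.prod_mul_distrib]
    simp
  have sum_single : ∑ j, (α + Pi.single i 1 : Fin d → ℝ) j + β = ∑ j, α j + β + 1 := by
    simp [Finset.sum_add_distrib, add_right_comm]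
  have A0 := (sum_add_pos hα hβ).ne'
  have := (Real.Gamma_pos_of_pos (sum_add_pos hα hβ)).ne'
  rw [dirichletBeta, dirichletBeta, gamma_prod, sum_single, Real.Gamma_add_one A0]
  field_simp

lemma dirichletDensity_eq {α : Fin d → ℝ} (hα : ∀ i, 0 ≤ α i) (β : ℝ) (x : Fin d → ℝ) :
    dirichletDensity α β x =
      (dirichletBeta α β)⁻¹ * ((1 - l1Norm x) ^ (β - 1) * ∏ i, x i ^ (α i - 1)) := by
  rw [dirichletDensity, dirichletBeta, inv_div, l1Norm_of_nonneg hα]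

@[fun_prop]
lemma measurable_dirichletDensity (α : Fin d → ℝ) (β : ℝ) : Measurable (dirichletDensity α β) := by
  unfold dirichletDensity
  fun_prop

lemma dirichletDensity_nonneg {α : Fin d → ℝ} {β : ℝ} (hα : ∀ i, 0 < α i) (hβ : 0 < β)
    {x : Fin d → ℝ} (hx : x ∈ simplex d) : 0 ≤ dirichletDensity α β x := by
  rw [dirichletDensity_eq fun i => (hα i).le]
  exact mul_nonneg (inv_nonneg.2 (dirichletBeta_pos hα hβ).le)
    (mul_nonneg (Real.rpow_nonneg (sub_nonneg.2 hx.2) _)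
      (Finset.prod_nonneg fun i _ => Real.rpow_nonneg (hx.1 i).1 _))

lemma integral_gammaPDFReal {a r : ℝ} (ha : 0 < a) (hr : 0 < r) : ∫ x, gammaPDFReal a r x = 1 := by
  rw [integral_eq_lintegral_of_nonneg_ae (ae_of_all _ (gammaPDFReal_nonneg ha hr))
    (measurable_gammaPDFReal a r).aestronglyMeasurable]
  exact (congrArg ENNReal.toReal (lintegral_gammaPDF_eq_one ha hr)).trans ENNReal.toReal_one

lemma lintegral_prod_gammaPDFReal {α : Fin d → ℝ} (hα : ∀ i, 0 < α i) {r : ℝ} (hr : 0 < r) :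
    ∫⁻ x : Fin d → ℝ, ENNReal.ofReal (∏ i, gammaPDFReal (α i) r (x i)) = 1 := by
  have integral_one (i) : ∫ x, gammaPDFReal (α i) r x = 1 := integral_gammaPDFReal (hα i) hr
  rw [← ofReal_integral_eq_lintegral_ofReal, integral_fintype_prod_volume_eq_prod
    fun i => gammaPDFReal (α i) r]
  · simp [integral_one]
  · exact Integrable.fintype_prod fun i =>
      .of_integral_ne_zero (by rw [integral_one]; exact one_ne_zero)
  · exact ae_of_all _ fun x => Finset.prod_nonneg fun i _ => gammaPDFReal_nonneg (hα i) hr _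

-- If `Y₁, …, Y_d, Z` are independent Gamma variables and `T = ∑ Yᵢ + Z`, this is the factorisation
-- of the joint density of `(T, Y / T)` which makes `T` and `Y / T` independent.
lemma pow_mul_prod_gammaPDFReal_mul {α : Fin d → ℝ} {β : ℝ} (hα : ∀ i, 0 < α i) (hβ : 0 < β)
    {t : ℝ} (ht : 0 < t) (x : Fin d → ℝ) :
    t ^ d * ((∏ i, gammaPDFReal (α i) 1 (t * x i)) * gammaPDFReal β 1 (t - ∑ i, t * x i)) =
      gammaPDFReal (∑ i, α i + β) 1 t * (simplex d).indicator (dirichletDensity α β) x := by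
  rw [← Finset.mul_sum, ← mul_one_sub]
  by_cases hx : x ∈ simplex d
  · obtain ⟨hx0, hx1⟩ := mem_simplex_iff.1 hx
    have prod_rpow : t ^ d * ∏ i, t ^ (α i - 1) = t ^ ∑ i, α i := by
      rw [← Real.rpow_sum_of_pos ht, ← Real.rpow_natCast, ← Real.rpow_add ht]
      simp [Finset.sum_sub_distrib]
    have exp_split : Real.exp (-t) =
        (∏ i, Real.exp (-(t * x i))) * Real.exp (-(t * (1 - ∑ i, x i))) := by
      rw [← Real.exp_sum, ← Real.exp_add, Finset.sum_neg_distrib, ← Finset.mul_sum]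
      ring_nf
    have := (Real.Gamma_pos_of_pos (sum_add_pos hα hβ)).ne'
    simp only [gammaPDFReal, if_pos ht.le, if_pos (mul_nonneg ht.le (hx0 _)),
      if_pos (mul_nonneg ht.le (sub_nonneg.2 hx1)), Set.indicator_of_mem hx,
      dirichletDensity_eq (fun i => (hα i).le), dirichletBeta, l1Norm_of_nonneg hx0,
      Real.mul_rpow ht.le (hx0 _), Real.mul_rpow ht.le (sub_nonneg.2 hx1), Real.one_rpow, one_mul,
      Finset.prod_mul_distrib, Finset.prod_div_distrib, Finset.prod_const_one, exp_split,
      add_sub_assoc, Real.rpow_add ht, ← prod_rpow]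
    field_simp
  · rw [Set.indicator_of_notMem hx, mul_zero]
    rw [mem_simplex_iff, not_and_or, not_forall] at hx
    rcases hx with ⟨i, hi⟩ | hx
    · rw [Finset.prod_eq_zero (Finset.mem_univ i), zero_mul, mul_zero]
      exact if_neg (not_le.2 (mul_neg_of_pos_of_neg ht (not_le.1 hi)))
    · have : gammaPDFReal β 1 (t * (1 - ∑ i, x i)) = 0 :=
        if_neg (not_le.2 (mul_neg_of_pos_of_neg ht (by linarith)))
      rw [this, mul_zero, mul_zero]

lemma lintegral_comp_smul {E : Type*} [NormedAddCommGroup E] [NormedSpace ℝ E]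
    [FiniteDimensional ℝ E] [MeasurableSpace E] [BorelSpace E] (μ : Measure E) [μ.IsAddHaarMeasure]
    {g : E → ENNReal} (hg : Measurable g) {t : ℝ} (ht : t ≠ 0) :
    ∫⁻ x, g (t • x) ∂μ = ENNReal.ofReal |(t ^ Module.finrank ℝ E)⁻¹| * ∫⁻ x, g x ∂μ := by
  rw [← lintegral_map hg (measurable_const_smul t), Measure.map_addHaar_smul μ ht,
    lintegral_smul_measure, smul_eq_mul]

lemma lintegral_prod_gammaPDFReal_mul {α : Fin d → ℝ} {β : ℝ} (hα : ∀ i, 0 < α i) (hβ : 0 < β)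
    {t : ℝ} (ht : t ≠ 0) :
    ∫⁻ y : Fin d → ℝ, ENNReal.ofReal ((∏ i, gammaPDFReal (α i) 1 (y i)) *
        gammaPDFReal β 1 (t - ∑ i, y i)) =
      ENNReal.ofReal (gammaPDFReal (∑ i, α i + β) 1 t) *
        ∫⁻ x in simplex d, ENNReal.ofReal (dirichletDensity α β x) := by
  have _ (a) : Measurable (gammaPDFReal a 1) := measurable_gammaPDFReal a 1
  rcases ht.lt_or_gt with ht | ht
  · have vanish (y : Fin d → ℝ) : (∏ i, gammaPDFReal (α i) 1 (y i)) *
        gammaPDFReal β 1 (t - ∑ i, y i) = 0 := by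
      by_cases hy : ∀ i, 0 ≤ y i
      · rw [gammaPDFReal.eq_def β, if_neg, mul_zero]
        linarith [Finset.sum_nonneg fun i (_ : i ∈ Finset.univ) => hy i]
      · obtain ⟨i, hi⟩ := not_forall.1 hy
        rw [Finset.prod_eq_zero (Finset.mem_univ i) (if_neg hi), zero_mul]
    rw [gammaPDFReal.eq_def _ _ t, if_neg ht.not_ge]
    simp [vanish]
  · have scale := lintegral_comp_smul (volume : Measure (Fin d → ℝ))
      (g := fun y => ENNReal.ofReal ((∏ i, gammaPDFReal (α i) 1 (y i)) *
        gammaPDFReal β 1 (t - ∑ i, y i))) (by fun_prop) ht.ne'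
    have pow_pos : 0 < t ^ d := pow_pos ht d
    rw [Module.finrank_fin_fun, abs_of_pos (inv_pos.2 pow_pos)] at scale
    calc _ = ENNReal.ofReal (t ^ d) * ∫⁻ x : Fin d → ℝ, ENNReal.ofReal
          ((∏ i, gammaPDFReal (α i) 1 ((t • x) i)) * gammaPDFReal β 1 (t - ∑ i, (t • x) i)) := by
          rw [scale, ← mul_assoc, ← ENNReal.ofReal_mul pow_pos.le, mul_inv_cancel₀ pow_pos.ne',
            ENNReal.ofReal_one, one_mul]
      _ = ∫⁻ x : Fin d → ℝ, ENNReal.ofReal (gammaPDFReal (∑ i, α i + β) 1 t) *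
          (simplex d).indicator (fun x => ENNReal.ofReal (dirichletDensity α β x)) x := by
          rw [← lintegral_const_mul _ (by fun_prop)]
          congr 1 with x
          rw [← ENNReal.ofReal_mul pow_pos.le]
          simp only [Pi.smul_apply, smul_eq_mul, pow_mul_prod_gammaPDFReal_mul hα hβ ht x]
          rw [ENNReal.ofReal_mul (gammaPDFReal_nonneg (sum_add_pos hα hβ) one_pos t)]
          by_cases hx : x ∈ simplex d <;> simp [hx]
      _ = _ := by
          rw [lintegral_const_mul _ (Measurable.indicator (by fun_prop) measurableSet_simplex),
            lintegral_indicator measurableSet_simplex]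

theorem lintegral_dirichletDensity {α : Fin d → ℝ} {β : ℝ} (hα : ∀ i, 0 < α i) (hβ : 0 < β) :
    ∫⁻ x in simplex d, ENNReal.ofReal (dirichletDensity α β x) = 1 := by
  have _ (a) : Measurable (gammaPDFReal a 1) := measurable_gammaPDFReal a 1
  have mass {a : ℝ} (ha : 0 < a) : ∫⁻ t, ENNReal.ofReal (gammaPDFReal a 1 t) = 1 :=
    lintegral_gammaPDF_eq_one ha one_pos
  calc ∫⁻ x in simplex d, ENNReal.ofReal (dirichletDensity α β x)
      = ∫⁻ t, ENNReal.ofReal (gammaPDFReal (∑ i, α i + β) 1 t) *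
          ∫⁻ x in simplex d, ENNReal.ofReal (dirichletDensity α β x) := by
        rw [lintegral_mul_const _ (by fun_prop), mass (sum_add_pos hα hβ), one_mul]
    _ = ∫⁻ t, ∫⁻ y : Fin d → ℝ, ENNReal.ofReal ((∏ i, gammaPDFReal (α i) 1 (y i)) *
          gammaPDFReal β 1 (t - ∑ i, y i)) := by
        refine lintegral_congr_ae ?_
        filter_upwards [Measure.ae_ne volume (0 : ℝ)] with t ht
        exact (lintegral_prod_gammaPDFReal_mul hα hβ ht).symm
    _ = ∫⁻ y : Fin d → ℝ, ∫⁻ t, ENNReal.ofReal ((∏ i, gammaPDFReal (α i) 1 (y i)) *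
          gammaPDFReal β 1 (t - ∑ i, y i)) := by
        refine lintegral_lintegral_swap (Measurable.aemeasurable ?_)
        simp only [Function.uncurry_def]
        fun_prop
    _ = ∫⁻ y : Fin d → ℝ, ENNReal.ofReal (∏ i, gammaPDFReal (α i) 1 (y i)) := by
        congr 1 with y
        simp_rw [ENNReal.ofReal_mul (Finset.prod_nonneg fun i (_ : i ∈ Finset.univ) =>
          gammaPDFReal_nonneg (hα i) one_pos (y i))]
        rw [lintegral_const_mul _ (by fun_prop), lintegral_sub_right_eq_self
          (fun t => ENNReal.ofReal (gammaPDFReal β 1 t)), mass hβ, mul_one]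
    _ = 1 := lintegral_prod_gammaPDFReal hα one_pos

lemma isProbabilityMeasure_lawOfDensity_dirichletDensity {α : Fin d → ℝ} {β : ℝ}
    (hα : ∀ i, 0 < α i) (hβ : 0 < β) :
    IsProbabilityMeasure (lawOfDensity (dirichletDensity α β)) :=
  ⟨by rw [lawOfDensity, withDensity_apply _ .univ, Measure.restrict_univ,
    lintegral_dirichletDensity hα hβ]⟩

lemma ae_mem_simplex (f : (Fin d → ℝ) → ℝ) : ∀ᵐ x ∂lawOfDensity f, x ∈ simplex d :=
  (withDensity_absolutelyContinuous _ _).ae_le (ae_restrict_mem measurableSet_simplex)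

lemma integral_lawOfDensity {f : (Fin d → ℝ) → ℝ} (hf : ∀ x ∈ simplex d, 0 ≤ f x)
    (hfm : AEMeasurable f (volume.restrict (simplex d))) (g : (Fin d → ℝ) → ℝ) :
    ∫ x, g x ∂lawOfDensity f = ∫ x in simplex d, f x * g x := by
  rw [lawOfDensity, integral_withDensity_eq_integral_toReal_smul₀ hfm.ennreal_ofReal
    (ae_of_all _ fun _ => ENNReal.ofReal_lt_top)]
  refine setIntegral_congr_fun measurableSet_simplex fun x hx => ?_
  simp only [ENNReal.toReal_ofReal (hf x hx), smul_eq_mul]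

lemma integral_lawOfDensity_comm {f g : (Fin d → ℝ) → ℝ} (hf : ∀ x ∈ simplex d, 0 ≤ f x)
    (hfm : AEMeasurable f (volume.restrict (simplex d))) (hg : ∀ x ∈ simplex d, 0 ≤ g x)
    (hgm : AEMeasurable g (volume.restrict (simplex d))) :
    ∫ x, g x ∂lawOfDensity f = ∫ x, f x ∂lawOfDensity g := by
  simp only [integral_lawOfDensity hf hfm, integral_lawOfDensity hg hgm, mul_comm]

lemma memLp_lawOfDensity_of_continuousOn {f h : (Fin d → ℝ) → ℝ} [IsFiniteMeasure (lawOfDensity f)]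
    (hh : ContinuousOn h (simplex d)) (p : ENNReal) : MemLp h p (lawOfDensity f) := by
  obtain ⟨C, hC⟩ := isCompact_simplex.exists_bound_of_continuousOn hh
  refine .of_bound ?_ C ((ae_mem_simplex f).mono hC)
  exact (hh.aestronglyMeasurable measurableSet_simplex).mono_ac
    (withDensity_absolutelyContinuous _ _)

lemma dirichletDensity_mul_rpow {α γ : Fin d → ℝ} {β δ : ℝ} (hα : ∀ i, 1 ≤ α i) (hβ : 1 ≤ β)
    (hγ : ∀ i, 0 ≤ γ i) (hδ : 0 ≤ δ) {x : Fin d → ℝ} (hx : x ∈ simplex d) :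
    dirichletDensity α β x * ((1 - l1Norm x) ^ δ * ∏ i, x i ^ γ i) =
      dirichletBeta (α + γ) (β + δ) / dirichletBeta α β * dirichletDensity (α + γ) (β + δ) x := by
  have pos : 0 < dirichletBeta (α + γ) (β + δ) :=
    dirichletBeta_pos (fun i => add_pos_of_pos_of_nonneg (one_pos.trans_le (hα i)) (hγ i))
      (add_pos_of_pos_of_nonneg (one_pos.trans_le hβ) hδ)
  have prod_rpow_add : ∏ i, x i ^ ((α + γ) i - 1) = (∏ i, x i ^ (α i - 1)) * ∏ i, x i ^ γ i := by
    rw [← Finset.prod_mul_distrib]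
    refine Finset.prod_congr rfl fun i _ => ?_
    rw [← Real.rpow_add_of_nonneg (hx.1 i).1 (sub_nonneg.2 (hα i)) (hγ i), Pi.add_apply,
      sub_add_eq_add_sub]
  rw [dirichletDensity_eq fun i => zero_le_one.trans (hα i),
    dirichletDensity_eq (α := α + γ) fun i => add_nonneg (zero_le_one.trans (hα i)) (hγ i),
    prod_rpow_add,
    ← sub_add_eq_add_sub, Real.rpow_add_of_nonneg (sub_nonneg.2 hx.2) (sub_nonneg.2 hβ) hδ]
  field_simp

lemma integral_monomial_dirichlet {α : Fin d → ℝ} {β : ℝ} (hα : ∀ i, 1 ≤ α i) (hβ : 1 ≤ β)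
    (u : Fin d → ℕ) :
    ∫ x, ∏ i, x i ^ u i ∂lawOfDensity (dirichletDensity α β) =
      dirichletBeta (α + fun i => (u i : ℝ)) β / dirichletBeta α β := by
  have α0 (i) : 0 < α i := one_pos.trans_le (hα i)
  have β0 : 0 < β := one_pos.trans_le hβ
  have αu0 (i) : 0 < (α + fun i => (u i : ℝ)) i := add_pos_of_pos_of_nonneg (α0 i) (u i).cast_nonneg
  have : IsProbabilityMeasure (lawOfDensity (dirichletDensity (α + fun i => (u i : ℝ)) β)) :=
    isProbabilityMeasure_lawOfDensity_dirichletDensity αu0 β0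
  have mass := integral_lawOfDensity (fun x hx => dirichletDensity_nonneg αu0 β0 hx)
    (by fun_prop) fun _ => 1
  simp only [integral_const, probReal_univ, one_smul, mul_one] at mass
  rw [integral_lawOfDensity (fun x hx => dirichletDensity_nonneg α0 β0 hx) (by fun_prop),
    ← mul_one (_ / _), mass, ← integral_const_mul]
  refine setIntegral_congr_fun measurableSet_simplex fun x hx => ?_
  have h := dirichletDensity_mul_rpow hα hβ (fun i => (u i).cast_nonneg) le_rfl hx
  simpa only [Real.rpow_zero, one_mul, Real.rpow_natCast, add_zero] using h

lemma integral_monomial_dirichlet_succ {α : Fin d → ℝ} {β : ℝ} (hα : ∀ i, 1 ≤ α i) (hβ : 1 ≤ β)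
    (u : Fin d → ℕ) (i : Fin d) :
    (∑ j, α j + β + ∑ j, (u j : ℝ)) *
        ∫ x, ∏ j, x j ^ (u + Pi.single i 1 : Fin d → ℕ) j ∂lawOfDensity (dirichletDensity α β) =
      (α i + u i) * ∫ x, ∏ j, x j ^ u j ∂lawOfDensity (dirichletDensity α β) := by
  have h := dirichletBeta_add_single (α := α + fun j => (u j : ℝ))
    (fun j => add_pos_of_pos_of_nonneg (one_pos.trans_le (hα j)) (u j).cast_nonneg)
    (one_pos.trans_le hβ) i
  have shift : (α + fun j => (((u + Pi.single i 1 : Fin d → ℕ) j : ℕ) : ℝ)) =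
      (α + fun j => (u j : ℝ)) + Pi.single i 1 := by
    ext j
    rcases eq_or_ne j i with rfl | hj
    · simp [add_assoc]
    · simp [hj]
  rw [integral_monomial_dirichlet hα hβ, integral_monomial_dirichlet hα hβ, shift, mul_div, mul_div]
  congr 1
  simpa only [Pi.add_apply, Finset.sum_add_distrib, add_right_comm] using h

open MvPolynomial in
lemma integrable_eval_lawOfDensity {f : (Fin d → ℝ) → ℝ} [IsFiniteMeasure (lawOfDensity f)]
    (p : MvPolynomial (Fin d) ℝ) : Integrable (fun x => eval x p) (lawOfDensity f) :=
  (memLp_lawOfDensity_of_continuousOn (continuous_eval p).continuousOn 1).integrable le_rfl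

open MvPolynomial in
lemma integral_eval_X_mul_monomial_dirichlet {α : Fin d → ℝ} {β : ℝ} (hα : ∀ i, 1 ≤ α i)
    (hβ : 1 ≤ β) (i : Fin d) (u : Fin d →₀ ℕ) (a : ℝ) :
    (∑ j, α j + β + ∑ j, (u j : ℝ)) *
        ∫ x, eval x (X i * monomial u a) ∂lawOfDensity (dirichletDensity α β) =
      (α i + u i) * ∫ x, eval x (monomial u a) ∂lawOfDensity (dirichletDensity α β) := by
  have prod_succ (x : Fin d → ℝ) :
      ∏ j, x j ^ (⇑u + Pi.single i 1 : Fin d → ℕ) j = x i * ∏ j, x j ^ u j := by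
    simp only [Pi.add_apply, pow_add, Finset.prod_mul_distrib, Pi.single_apply]
    simp [mul_comm]
  have recurrence := integral_monomial_dirichlet_succ hα hβ u i
  simp only [map_mul, eval_X, eval_monomial, Finsupp.prod_pow, mul_left_comm _ a, ← prod_succ,
    integral_const_mul, recurrence]

open MvPolynomial in
theorem integral_eval_stein_dirichlet {α : Fin d → ℝ} {β : ℝ} (hα : ∀ i, 1 ≤ α i) (hβ : 1 ≤ β)
    (i : Fin d) (p : MvPolynomial (Fin d) ℝ) :
    ∫ x, eval x ((C (∑ j, α j + β) * X i - C (α i)) * p)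
        ∂lawOfDensity (dirichletDensity α β) =
      ∫ x, eval x (X i * (pderiv i p - ∑ j, X j * pderiv j p))
        ∂lawOfDensity (dirichletDensity α β) := by
  have := isProbabilityMeasure_lawOfDensity_dirichletDensity
    (fun i => one_pos.trans_le (hα i)) (one_pos.trans_le hβ)
  have int (q : MvPolynomial (Fin d) ℝ) := integrable_eval_lawOfDensity
    (f := dirichletDensity α β) q
  induction p using MvPolynomial.induction_on' with
  | monomial u a =>
    have recurrence := integral_eval_X_mul_monomial_dirichlet hα hβ i u a
    have mul_pderiv (j : Fin d) : X j * pderiv j (monomial u a) = C (u j : ℝ) * monomial u a := by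
      rw [X_mul_pderiv_monomial, nsmul_eq_mul, map_natCast]
    have left : (C (∑ j, α j + β) * X i - C (α i)) * monomial u a =
        C (∑ j, α j + β) * (X i * monomial u a) - C (α i) * monomial u a := by
      ring
    have right : X i * (pderiv i (monomial u a) - ∑ j, X j * pderiv j (monomial u a)) =
        C (u i : ℝ) * monomial u a - C (∑ j, (u j : ℝ)) * (X i * monomial u a) := by
      simp only [mul_sub, mul_pderiv, ← Finset.sum_mul, ← map_sum, mul_left_comm (X i)]
    rw [left, right]
    simp only [map_sub (eval _), map_mul (eval _) (C _), eval_C]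
    rw [integral_sub ((int _).const_mul _) ((int _).const_mul _),
      integral_sub ((int _).const_mul _) ((int _).const_mul _)]
    simp only [integral_const_mul]
    linear_combination recurrence
  | add p q hp hq =>
    simp only [map_add, mul_add, add_sub_add_comm, Finset.sum_add_distrib] at hp hq ⊢
    rw [integral_add (int _) (int _), hp, hq, ← integral_add (int _) (int _)]

/-! ### Moments of the kernel -/

section KernelMoments

variable {s : Fin d → ℝ} {b : ℝ}

lemma one_le_div_add_one (hs : s ∈ simplex d) (hb : 0 < b) (i : Fin d) : 1 ≤ s i / b + 1 :=
  le_add_of_nonneg_left (div_nonneg (hs.1 i).1 hb.le)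

lemma one_le_one_sub_div_add_one (hs : s ∈ simplex d) (hb : 0 < b) :
    1 ≤ (1 - l1Norm s) / b + 1 :=
  le_add_of_nonneg_left (div_nonneg (sub_nonneg.2 hs.2) hb.le)

lemma sum_kernel_parameters (hs : s ∈ simplex d) (b : ℝ) :
    ∑ i, (s i / b + 1) + ((1 - l1Norm s) / b + 1) = b⁻¹ + d + 1 := by
  rw [Finset.sum_add_distrib, ← Finset.sum_div, l1Norm_of_nonneg fun i => (hs.1 i).1]
  simp only [Finset.sum_const, Finset.card_univ, Fintype.card_fin, nsmul_eq_mul, mul_one]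
  ring

lemma isProbabilityMeasure_kernel (hs : s ∈ simplex d) (hb : 0 < b) :
    IsProbabilityMeasure (lawOfDensity (kernel b s)) :=
  isProbabilityMeasure_lawOfDensity_dirichletDensity
    (fun i => one_pos.trans_le (one_le_div_add_one hs hb i))
    (one_pos.trans_le (one_le_one_sub_div_add_one hs hb))

lemma integrable_kernel (hs : s ∈ simplex d) (hb : 0 < b) {h : (Fin d → ℝ) → ℝ}
    (hh : ContinuousOn h (simplex d)) : Integrable h (lawOfDensity (kernel b s)) :=
  have := isProbabilityMeasure_kernel hs hb
  (memLp_lawOfDensity_of_continuousOn hh 1).integrable le_rfl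

lemma integral_kernel_mono (hs : s ∈ simplex d) (hb : 0 < b) {g h : (Fin d → ℝ) → ℝ}
    (hg : ContinuousOn g (simplex d)) (hh : ContinuousOn h (simplex d))
    (hgh : ∀ x ∈ simplex d, g x ≤ h x) :
    ∫ x, g x ∂lawOfDensity (kernel b s) ≤ ∫ x, h x ∂lawOfDensity (kernel b s) :=
  integral_mono_ae (integrable_kernel hs hb hg) (integrable_kernel hs hb hh)
    ((ae_mem_simplex _).mono hgh)

lemma abs_integral_kernel_le (hs : s ∈ simplex d) (hb : 0 < b) {g h : (Fin d → ℝ) → ℝ}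
    (hg : ContinuousOn g (simplex d)) (hh : ContinuousOn h (simplex d))
    (hgh : ∀ x ∈ simplex d, |g x| ≤ h x) :
    |∫ x, g x ∂lawOfDensity (kernel b s)| ≤ ∫ x, h x ∂lawOfDensity (kernel b s) :=
  abs_integral_le_integral_abs.trans (integral_kernel_mono hs hb hg.abs hh hgh)

open MvPolynomial in
lemma integral_kernel_sub_mul_eval (hs : s ∈ simplex d) (hb : 0 < b) (i : Fin d)
    (p : MvPolynomial (Fin d) ℝ) :
    ∫ x, (x i - s i) * eval x p ∂lawOfDensity (kernel b s) =
      b * ∫ x, eval x ((1 - C (d + 1 : ℝ) * X i) * p + X i * (pderiv i p - ∑ j, X j * pderiv j p))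
        ∂lawOfDensity (kernel b s) := by
  have stein := integral_eval_stein_dirichlet (one_le_div_add_one hs hb)
    (one_le_one_sub_div_add_one hs hb) i p
  have int (q : MvPolynomial (Fin d) ℝ) : Integrable (fun x => eval x q)
    (lawOfDensity (kernel b s)) := integrable_kernel hs hb (continuous_eval q).continuousOn
  have split : ∀ x, (x i - s i) * eval x p =
      b * (eval x ((C (b⁻¹ + d + 1) * X i - C (s i / b + 1)) * p) +
        eval x ((1 - C (d + 1 : ℝ) * X i) * p)) := by
    intro x
    simp only [map_mul, map_sub, eval_C, eval_X, map_one]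
    field_simp
    ring
  rw [sum_kernel_parameters hs] at stein
  simp only [split, integral_const_mul, map_add (eval _)]
  rw [integral_add (int _) (int _), integral_add (int _) (int _), add_comm]
  exact congrArg (fun r => b * (_ + r)) stein

open MvPolynomial in
lemma isBigO_integral_kernel_sub_mul_eval (hs : s ∈ simplex d) (i : Fin d)
    (p : MvPolynomial (Fin d) ℝ) :
    (fun b => ∫ x, (x i - s i) * eval x p ∂lawOfDensity (kernel b s)) =O[𝓝[>] 0] id := by
  obtain ⟨M, hM⟩ := isCompact_simplex.exists_bound_of_continuousOn (continuous_eval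
    ((1 - C (d + 1 : ℝ) * X i) * p + X i * (pderiv i p - ∑ j, X j * pderiv j p))).continuousOn
  refine .of_bound M ?_
  filter_upwards [self_mem_nhdsWithin] with b (hb : 0 < b)
  have := isProbabilityMeasure_kernel hs hb
  have bound := abs_integral_kernel_le hs hb (continuous_eval _).continuousOn
    continuousOn_const hM
  rw [integral_const, probReal_univ, one_smul] at bound
  rw [integral_kernel_sub_mul_eval hs hb, norm_mul, mul_comm]
  exact mul_le_mul_of_nonneg_right bound (norm_nonneg b)

lemma isBigO_integral_kernel_sub_sq (hs : s ∈ simplex d) (i : Fin d) :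
    (fun b => ∫ x, (x i - s i) ^ 2 ∂lawOfDensity (kernel b s)) =O[𝓝[>] 0] id := by
  refine (isBigO_integral_kernel_sub_mul_eval hs i (.X i - .C (s i))).congr_left fun b => ?_
  simp only [map_sub, MvPolynomial.eval_X, MvPolynomial.eval_C, pow_two]

open MvPolynomial in
lemma isBigO_integral_kernel_sub_pow_four (hs : s ∈ simplex d) (i : Fin d) :
    (fun b => ∫ x, (x i - s i) ^ 4 ∂lawOfDensity (kernel b s)) =O[𝓝[>] 0] fun b => b ^ 2 := by
  let Y : MvPolynomial (Fin d) ℝ := X i - C (s i)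
  let q : MvPolynomial (Fin d) ℝ := (1 - C (d + 1 : ℝ) * X i) * Y ^ 2 + 3 * (X i - X i ^ 2) * Y
  have pderiv_cube (j) : pderiv j (Y ^ 3) = if j = i then 3 * Y ^ 2 else 0 := by
    rcases eq_or_ne j i with rfl | h
    · simp [Y, Derivation.leibniz_pow]
    · simp [Y, Derivation.leibniz_pow, pderiv_X_of_ne h.symm, h]
  have stein_cube : (1 - C (d + 1 : ℝ) * X i) * Y ^ 3 +
      X i * (pderiv i (Y ^ 3) - ∑ j, X j * pderiv j (Y ^ 3)) = Y * q := by
    simp only [pderiv_cube, if_true, mul_ite, mul_zero, Finset.sum_ite_eq', Finset.mem_univ, q]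
    ring
  refine ((Asymptotics.isBigO_refl id _).mul (isBigO_integral_kernel_sub_mul_eval hs i q)).congr'
    ?_ (.of_forall fun b => (sq b).symm)
  filter_upwards [self_mem_nhdsWithin] with b (hb : 0 < b)
  have h := integral_kernel_sub_mul_eval hs hb i (Y ^ 3)
  simp only [stein_cube, map_mul, map_pow, Y, map_sub, eval_X, eval_C, ← pow_succ'] at h
  exact h.symm

lemma isBigO_integral_kernel_norm_pow (hs : s ∈ simplex d) {k : ℕ} (hk : Even k) (hk0 : k ≠ 0)
    {g : ℝ → ℝ}
    (hg : ∀ i, (fun b => ∫ x, (x i - s i) ^ k ∂lawOfDensity (kernel b s)) =O[𝓝[>] 0] g) :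
    (fun b => ∫ x, ‖x - s‖ ^ k ∂lawOfDensity (kernel b s)) =O[𝓝[>] 0] g := by
  have norm_pow_le (x : Fin d → ℝ) : ‖x - s‖ ^ k ≤ ∑ i, (x i - s i) ^ k := by
    simp only [← hk.pow_abs (_ - _)]
    rcases isEmpty_or_nonempty (Fin d) with _ | _
    · simp [Subsingleton.elim x s, hk0]
    · obtain ⟨i, hi⟩ := Finite.exists_max fun i => ‖(x - s) i‖
      have : ‖x - s‖ ≤ ‖(x - s) i‖ := (pi_norm_le_iff_of_nonneg (norm_nonneg _)).2 hi
      exact (pow_le_pow_left₀ (norm_nonneg _) this k).trans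
        (Finset.single_le_sum (f := fun i => |x i - s i| ^ k) (fun i _ => by positivity)
          (Finset.mem_univ i))
  refine .trans (.of_bound 1 ?_) (.sum fun i (_ : i ∈ Finset.univ) => hg i)
  filter_upwards [self_mem_nhdsWithin] with b (hb : 0 < b)
  rw [one_mul, Finset.sum_apply, ← integral_finsetSum _ fun i _ =>
    integrable_kernel hs hb (by fun_prop),
    Real.norm_of_nonneg (integral_nonneg fun x => by positivity)]
  exact (integral_kernel_mono hs hb (by fun_prop) (by fun_prop) fun x _ => norm_pow_le x).trans
    (le_abs_self _)

lemma isBigO_integral_kernel_norm_sq (hs : s ∈ simplex d) :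
    (fun b => ∫ x, ‖x - s‖ ^ 2 ∂lawOfDensity (kernel b s)) =O[𝓝[>] 0] id :=
  isBigO_integral_kernel_norm_pow hs even_two two_ne_zero (isBigO_integral_kernel_sub_sq hs)

lemma isBigO_integral_kernel_norm_pow_four (hs : s ∈ simplex d) :
    (fun b => ∫ x, ‖x - s‖ ^ 4 ∂lawOfDensity (kernel b s)) =O[𝓝[>] 0] fun b => b ^ 2 :=
  isBigO_integral_kernel_norm_pow hs (by decide) four_ne_zero
    (isBigO_integral_kernel_sub_pow_four hs)

lemma isBigO_integral_kernel_norm (hs : s ∈ simplex d) :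
    (fun b => ∫ x, ‖x - s‖ ∂lawOfDensity (kernel b s)) =O[𝓝[>] 0] Real.sqrt := by
  obtain ⟨C, hC⟩ := (isBigO_integral_kernel_norm_sq hs).bound
  refine .of_bound √C ?_
  filter_upwards [hC, self_mem_nhdsWithin] with b hCb (hb : 0 < b)
  have := isProbabilityMeasure_kernel hs hb
  have second : ∫ x, ‖x - s‖ ^ 2 ∂lawOfDensity (kernel b s) ≤ C * b := by
    simpa only [id, Real.norm_of_nonneg hb.le] using (Real.le_norm_self _).trans hCb
  have jensen : (∫ x, ‖x - s‖ ∂lawOfDensity (kernel b s)) ^ 2 ≤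
      ∫ x, ‖x - s‖ ^ 2 ∂lawOfDensity (kernel b s) := by
    have := variance_nonneg (fun x => ‖x - s‖) (lawOfDensity (kernel b s))
    rw [variance_eq_sub (memLp_lawOfDensity_of_continuousOn (by fun_prop) 2)] at this
    exact sub_nonneg.1 this
  rw [Real.norm_of_nonneg (Real.sqrt_nonneg b), ← Real.sqrt_mul' _ hb.le]
  exact Real.abs_le_sqrt (jensen.trans second)

end KernelMoments

/-! ### Smoothing by the kernel -/

lemma exists_abs_le_mul_norm_pow_add {E : Type*} [SeminormedAddCommGroup E] {K : Set E}
    (hK : IsCompact K) {h : E → ℝ} (hh : ContinuousOn h K) {s : E} {a : ℝ} (ha : 0 ≤ a) {k : ℕ}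
    (hs : ∀ᶠ x in 𝓝[K] s, |h x| ≤ a * ‖x - s‖ ^ k) (m : ℕ) :
    ∃ C, ∀ x ∈ K, |h x| ≤ a * ‖x - s‖ ^ k + C * ‖x - s‖ ^ m := by
  obtain ⟨r, r0, hr⟩ := Metric.mem_nhdsWithin_iff.1 hs
  obtain ⟨M, hM⟩ := hK.exists_bound_of_continuousOn hh
  refine ⟨|M| / r ^ m, fun x hx => ?_⟩
  rcases lt_or_ge (dist x s) r with hxs | hxs
  · exact (hr ⟨hxs, hx⟩).trans (le_add_of_nonneg_right (by positivity))
  · rw [dist_eq_norm] at hxs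
    calc |h x| ≤ |M| / r ^ m * r ^ m := by
          rw [div_mul_cancel₀ _ (pow_pos r0 m).ne']
          exact (hM x hx).trans (le_abs_self M)
      _ ≤ |M| / r ^ m * ‖x - s‖ ^ m := by gcongr
      _ ≤ _ := le_add_of_nonneg_left (by positivity)

section Smoothing

variable {s : Fin d → ℝ} {f h : (Fin d → ℝ) → ℝ}

lemma isLittleO_integral_kernel (hs : s ∈ simplex d) (hh : ContinuousOn h (simplex d)) {k m : ℕ}
    (ho : h =o[𝓝[simplex d] s] fun x => ‖x - s‖ ^ k) {g : ℝ → ℝ}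
    (hk : (fun b => ∫ x, ‖x - s‖ ^ k ∂lawOfDensity (kernel b s)) =O[𝓝[>] 0] g)
    (hm : (fun b => ∫ x, ‖x - s‖ ^ m ∂lawOfDensity (kernel b s)) =o[𝓝[>] 0] g) :
    (fun b => ∫ x, h x ∂lawOfDensity (kernel b s)) =o[𝓝[>] 0] g := by
  obtain ⟨M, M0, hM⟩ := hk.exists_pos
  refine Asymptotics.isLittleO_iff.2 fun ε ε0 => ?_
  have near : ∀ᶠ x in 𝓝[simplex d] s, |h x| ≤ ε / (2 * M) * ‖x - s‖ ^ k := by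
    filter_upwards [ho.def (c := ε / (2 * M)) (by positivity)] with x hx
    rwa [norm_pow, norm_norm] at hx
  obtain ⟨C, hC⟩ := exists_abs_le_mul_norm_pow_add isCompact_simplex hh (by positivity) near m
  filter_upwards [hM.bound, (hm.const_mul_left C).def (half_pos ε0), self_mem_nhdsWithin]
    with b hbk hbm (hb : 0 < b)
  calc ‖∫ x, h x ∂lawOfDensity (kernel b s)‖
      ≤ ∫ x, (ε / (2 * M) * ‖x - s‖ ^ k + C * ‖x - s‖ ^ m) ∂lawOfDensity (kernel b s) :=
        abs_integral_kernel_le hs hb hh (by fun_prop) hC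
    _ = ε / (2 * M) * ∫ x, ‖x - s‖ ^ k ∂lawOfDensity (kernel b s) +
        C * ∫ x, ‖x - s‖ ^ m ∂lawOfDensity (kernel b s) := by
        rw [integral_add (integrable_kernel hs hb (by fun_prop))
          (integrable_kernel hs hb (by fun_prop)), integral_const_mul, integral_const_mul]
    _ ≤ ε / (2 * M) * (M * ‖g b‖) + ε / 2 * ‖g b‖ := by
        exact add_le_add (mul_le_mul_of_nonneg_left ((Real.le_norm_self _).trans hbk)
          (by positivity)) ((Real.le_norm_self _).trans hbm)
    _ = ε * ‖g b‖ := by field_simp; ring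

lemma integral_kernel_sub_const (hs : s ∈ simplex d) {b : ℝ} (hb : 0 < b)
    (hh : ContinuousOn h (simplex d)) (c : ℝ) :
    ∫ x, (h x - c) ∂lawOfDensity (kernel b s) = ∫ x, h x ∂lawOfDensity (kernel b s) - c := by
  have := isProbabilityMeasure_kernel hs hb
  rw [integral_sub (integrable_kernel hs hb hh) (integrable_const c), integral_const,
    probReal_univ, one_smul]

theorem tendsto_integral_kernel (hs : s ∈ simplex d) (hh : ContinuousOn h (simplex d)) :
    Tendsto (fun b => ∫ x, h x ∂lawOfDensity (kernel b s)) (𝓝[>] 0) (𝓝 (h s)) := by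
  have mass : (fun b => ∫ x, ‖x - s‖ ^ 0 ∂lawOfDensity (kernel b s)) =O[𝓝[>] 0]
      (fun _ => (1 : ℝ)) := by
    refine .of_bound 1 ?_
    filter_upwards [self_mem_nhdsWithin] with b (hb : 0 < b)
    have := isProbabilityMeasure_kernel hs hb
    simp
  have second : (fun b => ∫ x, ‖x - s‖ ^ 2 ∂lawOfDensity (kernel b s)) =o[𝓝[>] 0]
      (fun _ => (1 : ℝ)) :=
    (isBigO_integral_kernel_norm_sq hs).trans_isLittleO
      ((Asymptotics.isLittleO_one_iff ℝ).2 (tendsto_id.mono_left nhdsWithin_le_nhds))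
  have vanish : (fun x => h x - h s) =o[𝓝[simplex d] s] fun x => ‖x - s‖ ^ 0 := by
    simp only [pow_zero, Asymptotics.isLittleO_one_iff]
    exact tendsto_sub_nhds_zero_iff.2 (hh s hs)
  have lim := isLittleO_integral_kernel hs (hh.sub continuousOn_const) vanish mass second
  rw [Asymptotics.isLittleO_one_iff] at lim
  refine tendsto_sub_nhds_zero_iff.1 (lim.congr' ?_)
  filter_upwards [self_mem_nhdsWithin] with b (hb : 0 < b)
  exact integral_kernel_sub_const hs hb hh (h s)

lemma isBigO_integral_kernel_sub (hs : s ∈ simplex d) (hf : ContinuousOn f (simplex d))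
    (hfs : (fun x => f x - f s) =O[𝓝[simplex d] s] fun x => x - s) :
    (fun b => ∫ x, f x ∂lawOfDensity (kernel b s) - f s) =O[𝓝[>] 0] Real.sqrt := by
  obtain ⟨a, a0, ha⟩ := hfs.exists_nonneg
  have near : ∀ᶠ x in 𝓝[simplex d] s, |f x - f s| ≤ a * ‖x - s‖ ^ 1 := by
    simpa only [pow_one, Real.norm_eq_abs] using ha.bound
  obtain ⟨C, hC⟩ := exists_abs_le_mul_norm_pow_add isCompact_simplex
    (hf.sub continuousOn_const) a0 near 1
  refine .trans (.of_bound (a + C) ?_) (isBigO_integral_kernel_norm hs)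
  filter_upwards [self_mem_nhdsWithin] with b (hb : 0 < b)
  rw [← integral_kernel_sub_const hs hb hf, Real.norm_of_nonneg
    (integral_nonneg fun x => norm_nonneg _ : 0 ≤ ∫ x, ‖x - s‖ ∂lawOfDensity (kernel b s)),
    ← integral_const_mul]
  exact abs_integral_kernel_le hs hb (hf.sub continuousOn_const) (by fun_prop)
    fun x hx => (hC x hx).trans_eq (by rw [pow_one, add_mul])

open MvPolynomial in
lemma tendsto_inv_mul_integral_kernel_sub_mul_eval (hs : s ∈ simplex d) (i : Fin d)
    (p : MvPolynomial (Fin d) ℝ) :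
    Tendsto (fun b => b⁻¹ * ∫ x, (x i - s i) * eval x p ∂lawOfDensity (kernel b s)) (𝓝[>] 0)
      (𝓝 ((1 - (d + 1) * s i) * eval s p +
        s i * (eval s (pderiv i p) - ∑ j, s j * eval s (pderiv j p)))) := by
  have lim := tendsto_integral_kernel hs (continuous_eval
    ((1 - C (d + 1 : ℝ) * X i) * p + X i * (pderiv i p - ∑ j, X j * pderiv j p))).continuousOn
  simp only [map_add (eval s), map_mul, map_sub, map_sum, map_one, eval_C, eval_X] at lim
  refine lim.congr' ?_
  filter_upwards [self_mem_nhdsWithin] with b (hb : 0 < b)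
  rw [integral_kernel_sub_mul_eval hs hb, inv_mul_cancel_left₀ hb.ne']

/-! ### Second order expansion of the bias -/

theorem isLittleO_sub_taylor_two {E : Type*} [NormedAddCommGroup E] [NormedSpace ℝ E]
    {f : E → ℝ} {s : E} (hf : ContDiffAt ℝ 2 f s) :
    (fun x => f x - f s - (fderiv ℝ f s (x - s) +
      1 / 2 * fderiv ℝ (fderiv ℝ f) s (x - s) (x - s))) =o[𝓝 s] fun x => ‖x - s‖ ^ 2 := by
  set A := fderiv ℝ f s
  set H := fderiv ℝ (fderiv ℝ f) s
  have symm : IsSymmSndFDerivAt ℝ f s := hf.isSymmSndFDerivAt (by simp)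
  have deriv_lin : HasFDerivAt (fderiv ℝ f) H s :=
    ((hf.fderiv_right (m := 1) (by norm_num)).differentiableAt one_ne_zero).hasFDerivAt
  have diff : ∀ᶠ x in 𝓝 s, DifferentiableAt ℝ f x :=
    (hf.eventually (by simp)).mono fun x hx => hx.differentiableAt two_ne_zero
  obtain ⟨δ, δ0, hδ⟩ := Metric.eventually_nhds_iff_ball.1 diff
  have deriv (x) (hx : x ∈ Metric.ball s δ) :
      HasFDerivWithinAt (fun x => f x - (A (x - s) + 1 / 2 * H (x - s) (x - s)))
        (fderiv ℝ f x - A - H (x - s)) (Metric.ball s δ) x := by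
    have sub_deriv : HasFDerivAt (fun x => x - s) (ContinuousLinearMap.id ℝ E) x :=
      (hasFDerivAt_id x).sub_const s
    have quad := ((H.hasFDerivAt.comp x sub_deriv).clm_apply sub_deriv).const_mul (1 / 2)
    refine ((hδ x hx).hasFDerivAt.sub ((A.hasFDerivAt.comp x sub_deriv).add
      quad)).hasFDerivWithinAt.congr_fderiv ?_
    ext v
    have symm_v : H v (x - s) = H (x - s) v := symm v (x - s)
    simp only [ContinuousLinearMap.comp_id, Function.comp_apply, smul_add, sub_apply, add_apply,
      smul_apply, smul_eq_mul, ContinuousLinearMap.flip_apply, symm_v]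
    ring
  have deriv_small : (fun x => fderiv ℝ f x - A - H (x - s)) =o[𝓝[Metric.ball s δ] s]
      fun x => ‖x - s‖ ^ 1 := by
    simp only [pow_one]
    exact (hasFDerivAt_iff_isLittleO.1 deriv_lin).norm_right.mono nhdsWithin_le_nhds
  have small := (convex_ball s δ).isLittleO_pow_succ (Metric.mem_ball_self δ0) deriv deriv_small
  rw [Metric.isOpen_ball.nhdsWithin_eq (Metric.mem_ball_self δ0)] at small
  refine small.congr_left fun x => ?_
  simp only [sub_self, map_zero, mul_zero, add_zero, sub_zero]
  ring

lemma partialDeriv_eq (hs : s ∈ simplexInterior d) (f : (Fin d → ℝ) → ℝ) (i : Fin d) :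
    partialDeriv i f s = fderiv ℝ f s (Pi.single i 1) := by
  rw [partialDeriv, fderivWithin_of_mem_nhds (simplex_mem_nhds hs)]

lemma partialDeriv_partialDeriv_eq (hs : s ∈ simplexInterior d) (hf : ContDiffAt ℝ 2 f s)
    (i j : Fin d) :
    partialDeriv i (partialDeriv j f) s =
      fderiv ℝ (fderiv ℝ f) s (Pi.single i 1) (Pi.single j 1) := by
  have diff : DifferentiableAt ℝ (fderiv ℝ f) s :=
    (hf.fderiv_right (m := 1) (by norm_num)).differentiableAt one_ne_zero
  have near : partialDeriv j f =ᶠ[𝓝 s] fun x => fderiv ℝ f x (Pi.single j 1) := by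
    filter_upwards [isOpen_simplexInterior.mem_nhds hs] with x hx using partialDeriv_eq hx f j
  rw [partialDeriv_eq hs, near.fderiv_eq, fderiv_clm_apply diff (differentiableAt_const _)]
  simp

lemma clm_apply_eq_sum (A : (Fin d → ℝ) →L[ℝ] ℝ) (v : Fin d → ℝ) :
    A v = ∑ i, v i * A (Pi.single i 1) := by
  conv_lhs => rw [pi_eq_sum_univ' v]
  simp only [map_sum, map_smul, smul_eq_mul]

open MvPolynomial in
theorem isLittleO_sub_sub_sum_mul_eval (hs : s ∈ simplexInterior d) (hf : ContDiffAt ℝ 2 f s) :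
    (fun x => f x - f s - ∑ i, (x i - s i) * eval x (C (partialDeriv i f s) +
      ∑ j, C (1 / 2 * partialDeriv i (partialDeriv j f) s) * (X j - C (s j)))) =o[𝓝 s]
        fun x => ‖x - s‖ ^ 2 := by
  refine (isLittleO_sub_taylor_two hf).congr_left fun x => ?_
  have second : fderiv ℝ (fderiv ℝ f) s (x - s) (x - s) =
      ∑ i, (x i - s i) * ∑ j, (x j - s j) * partialDeriv i (partialDeriv j f) s := by
    simp only [partialDeriv_partialDeriv_eq hs hf, ← Pi.sub_apply x s, ← clm_apply_eq_sum]
    exact clm_apply_eq_sum ((fderiv ℝ (fderiv ℝ f) s).flip (x - s)) (x - s)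
  rw [second, clm_apply_eq_sum, Finset.mul_sum, ← Finset.sum_add_distrib]
  refine congrArg _ (Finset.sum_congr rfl fun i _ => ?_)
  simp only [map_add, map_sum, map_mul, map_sub, eval_C, eval_X, partialDeriv_eq hs f i,
    mul_add, Finset.mul_sum, Pi.sub_apply]
  refine congrArg _ (Finset.sum_congr rfl fun j _ => ?_)
  ring

open MvPolynomial in
theorem tendsto_inv_mul_integral_kernel_sub (hs : s ∈ simplexInterior d)
    (hfc : ContinuousOn f (simplex d)) (hf : ContDiffAt ℝ 2 f s) :
    Tendsto (fun b => b⁻¹ * (∫ x, f x ∂lawOfDensity (kernel b s) - f s)) (𝓝[>] 0)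
      (𝓝 (biasTerm f s)) := by
  have hs' := simplexInterior_subset hs
  let p (i : Fin d) : MvPolynomial (Fin d) ℝ := C (partialDeriv i f s) +
    ∑ j, C (1 / 2 * partialDeriv i (partialDeriv j f) s) * (X j - C (s j))
  let r (x : Fin d → ℝ) : ℝ := f x - f s - ∑ i, (x i - s i) * eval x (p i)
  have cont_eval (i) : Continuous fun x : Fin d → ℝ => (x i - s i) * eval x (p i) :=
    ((continuous_apply i).sub continuous_const).mul (continuous_eval _)
  have cont_sum : Continuous fun x : Fin d → ℝ => ∑ i, (x i - s i) * eval x (p i) :=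
    continuous_finsetSum _ fun i _ => cont_eval i
  have cont_r : ContinuousOn r (simplex d) :=
    (hfc.sub continuousOn_const).sub cont_sum.continuousOn
  have remainder : Tendsto (fun b => b⁻¹ * ∫ x, r x ∂lawOfDensity (kernel b s)) (𝓝[>] 0)
      (𝓝 0) := by
    have := isLittleO_integral_kernel hs' cont_r
      ((isLittleO_sub_sub_sum_mul_eval hs hf).mono nhdsWithin_le_nhds)
      (isBigO_integral_kernel_norm_sq hs') (g := id) (m := 4)
      ((isBigO_integral_kernel_norm_pow_four hs').trans_isLittleO
        ((Asymptotics.isLittleO_pow_id one_lt_two).mono nhdsWithin_le_nhds))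
    simpa only [id, div_eq_inv_mul] using this.tendsto_div_nhds_zero
  have lim := (tendsto_finsetSum Finset.univ fun i _ =>
    tendsto_inv_mul_integral_kernel_sub_mul_eval hs' i (p i)).add remainder
  have eval_p (i) : eval s (p i) = partialDeriv i f s := by simp [p]
  have eval_pderiv (i j) : eval s (pderiv j (p i)) =
      1 / 2 * partialDeriv i (partialDeriv j f) s := by
    simp [p, Derivation.leibniz, pderiv_X, Pi.single_apply]
  have limit_eq : ∑ i, ((1 - (d + 1) * s i) * eval s (p i) + s i * (eval s (pderiv i (p i)) -
      ∑ j, s j * eval s (pderiv j (p i)))) + 0 = biasTerm f s := by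
    simp only [eval_p, eval_pderiv, biasTerm, add_zero, Finset.sum_add_distrib, Finset.mul_sum,
      mul_sub, sub_mul, Finset.sum_sub_distrib, mul_ite, ite_mul, mul_one, mul_zero, zero_mul,
      Finset.sum_ite_eq, Finset.mem_univ, if_true]
    ring_nf
  rw [limit_eq] at lim
  refine lim.congr' ?_
  filter_upwards [self_mem_nhdsWithin] with b (hb : 0 < b)
  rw [← Finset.mul_sum, ← integral_finsetSum _ fun i _ =>
    integrable_kernel hs' hb (cont_eval i).continuousOn, ← mul_add,
    ← integral_add (integrable_kernel hs' hb cont_sum.continuousOn)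
      (integrable_kernel hs' hb cont_r), ← integral_kernel_sub_const hs' hb hfc]
  simp only [r, add_sub_cancel]

end Smoothing

/-! ### Ratios of Gamma functions -/

lemma Gamma_midpoint_sq_le {x y : ℝ} (hx : 0 < x) (hy : 0 < y) :
    Real.Gamma ((x + y) / 2) ^ 2 ≤ Real.Gamma x * Real.Gamma y := by
  have gx := Real.Gamma_pos_of_pos hx
  have gy := Real.Gamma_pos_of_pos hy
  have log_convex := Real.Gamma_mul_add_mul_le_rpow_Gamma_mul_rpow_Gamma hx hy
    one_half_pos one_half_pos (add_halves 1)
  rw [← mul_add, one_div_mul_eq_div, ← Real.sqrt_eq_rpow, ← Real.sqrt_eq_rpow,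
    ← Real.sqrt_mul gx.le] at log_convex
  exact (pow_le_pow_left₀ (Real.Gamma_pos_of_pos (half_pos (add_pos hx hy))).le log_convex
    2).trans_eq (Real.sq_sqrt (mul_pos gx gy).le)

lemma mul_Gamma_add_half_sq_le {z : ℝ} (hz : 0 < z) :
    z * Real.Gamma (z + 1 / 2) ^ 2 ≤ Real.Gamma (z + 1) ^ 2 := by
  have midpoint := Gamma_midpoint_sq_le hz (add_pos hz one_pos)
  rw [show (z + (z + 1)) / 2 = z + 1 / 2 by ring] at midpoint
  calc z * Real.Gamma (z + 1 / 2) ^ 2 ≤ z * (Real.Gamma z * Real.Gamma (z + 1)) := by gcongr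
    _ = Real.Gamma (z + 1) ^ 2 := by rw [Real.Gamma_add_one hz.ne']; ring

lemma Gamma_add_one_sq_le {z : ℝ} (hz : 0 < z) :
    Real.Gamma (z + 1) ^ 2 ≤ (z + 1 / 2) * Real.Gamma (z + 1 / 2) ^ 2 := by
  have hz' : 0 < z + 1 / 2 := by positivity
  have midpoint := Gamma_midpoint_sq_le hz' (add_pos hz' one_pos)
  rw [show (z + 1 / 2 + (z + 1 / 2 + 1)) / 2 = z + 1 by ring, Real.Gamma_add_one hz'.ne']
    at midpoint
  exact midpoint.trans_eq (by ring)

lemma tendsto_sqrt_mul_Gamma_add_half_div_Gamma_add_one :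
    Tendsto (fun z => √z * Real.Gamma (z + 1 / 2) / Real.Gamma (z + 1)) atTop (𝓝 1) := by
  have lower : Tendsto (fun z : ℝ => z / (z + 1 / 2)) atTop (𝓝 1) := by
    have decay : Tendsto (fun z : ℝ => 1 - 1 / 2 / (z + 1 / 2)) atTop (𝓝 1) := by
      simpa only [sub_zero, id] using (tendsto_const_nhds.div_atTop
        (tendsto_atTop_add_const_right _ (1 / 2) tendsto_id)).const_sub (1 : ℝ)
    refine decay.congr' ?_
    filter_upwards [eventually_gt_atTop 0] with z hz
    rw [one_sub_div (by positivity), add_sub_cancel_right]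
  have sq : Tendsto (fun z => (√z * Real.Gamma (z + 1 / 2) / Real.Gamma (z + 1)) ^ 2) atTop
      (𝓝 1) := by
    refine tendsto_of_tendsto_of_tendsto_of_le_of_le' lower tendsto_const_nhds ?_ ?_ <;>
      filter_upwards [eventually_gt_atTop 0] with z hz <;>
      have _ := Real.Gamma_pos_of_pos (add_pos hz one_pos) <;>
      rw [div_pow, mul_pow, Real.sq_sqrt hz.le]
    · rw [div_le_div_iff₀ (by positivity) (by positivity)]
      exact (mul_le_mul_of_nonneg_left (Gamma_add_one_sq_le hz) hz.le).trans_eq (by ring)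
    · exact div_le_one_of_le₀ (mul_Gamma_add_half_sq_le hz) (by positivity)
  have root := sq.sqrt
  rw [Real.sqrt_one] at root
  refine root.congr' ?_
  filter_upwards [eventually_gt_atTop 0] with z hz
  have := Real.Gamma_pos_of_pos (add_pos hz one_half_pos)
  have := Real.Gamma_pos_of_pos (add_pos hz one_pos)
  exact Real.sqrt_sq (by positivity)

/-- The central binomial coefficient `C(2z, z) = Γ(2z + 1) / Γ(z + 1)²` at a real argument, divided
by its order of growth `4 ^ z / √z`. -/
noncomputable def scaledCentralBinom (z : ℝ) : ℝ :=
  √z / 4 ^ z * (Real.Gamma (2 * z + 1) / Real.Gamma (z + 1) ^ 2)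

lemma tendsto_scaledCentralBinom : Tendsto scaledCentralBinom atTop (𝓝 (√Real.pi)⁻¹) := by
  have lim := tendsto_sqrt_mul_Gamma_add_half_div_Gamma_add_one.const_mul (√Real.pi)⁻¹
  rw [mul_one] at lim
  refine lim.congr' ?_
  filter_upwards [eventually_gt_atTop 0] with z hz
  have duplication := Real.Gamma_mul_Gamma_add_half (z + 1 / 2)
  rw [show z + 1 / 2 + 1 / 2 = z + 1 by ring, show 2 * (z + 1 / 2) = 2 * z + 1 by ring,
    show 1 - (2 * z + 1) = -(2 * z) by ring, Real.rpow_neg two_pos.le, Real.rpow_mul two_pos.le,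
    Real.rpow_two, show (2 : ℝ) ^ 2 = 4 by norm_num] at duplication
  have g := Real.Gamma_pos_of_pos (add_pos hz one_pos)
  rw [scaledCentralBinom, eq_div_of_mul_eq g.ne' duplication]
  field_simp

lemma Gamma_two_mul_add_one_div_sq {z : ℝ} (hz : 0 < z) :
    Real.Gamma (2 * z + 1) / Real.Gamma (z + 1) ^ 2 = 4 ^ z / √z * scaledCentralBinom z := by
  rw [scaledCentralBinom]
  field_simp

lemma tendsto_Gamma_add_nat_add_one_div (n : ℕ) :
    Tendsto (fun z => Real.Gamma (z + n + 1) / Real.Gamma (z + 1) / z ^ n) atTop (𝓝 1) := by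
  induction n with
  | zero =>
    refine tendsto_const_nhds.congr' ?_
    filter_upwards [eventually_gt_atTop 0] with z hz
    have g := Real.Gamma_pos_of_pos (add_pos hz one_pos)
    simp [g.ne']
  | succ n ih =>
    have factor : Tendsto (fun z : ℝ => 1 + (n + 1) / z) atTop (𝓝 1) := by
      simpa using (tendsto_const_nhds.div_atTop tendsto_id).const_add (1 : ℝ)
    have lim := factor.mul ih
    rw [one_mul] at lim
    refine lim.congr' ?_
    filter_upwards [eventually_gt_atTop 0] with z hz
    have _ := Real.Gamma_pos_of_pos (add_pos hz one_pos)
    rw [Nat.cast_succ, ← add_assoc z, Real.Gamma_add_one (s := z + n + 1) (by positivity)]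
    field_simp
    ring

/-! ### The square of the kernel -/

lemma dirichletBeta_two_mul_add_one_div_sq {u : Fin d → ℝ} {v : ℝ} (hu : ∀ i, 0 < u i)
    (hv : 0 < v) :
    let N := ∑ i, u i + v
    dirichletBeta (fun i => 2 * u i + 1) (2 * v + 1) /
        dirichletBeta (fun i => u i + 1) (v + 1) ^ 2 =
      √N / ((∏ i, √(u i)) * √v) *
        ((∏ i, scaledCentralBinom (u i)) * scaledCentralBinom v / scaledCentralBinom N) *
        ((Real.Gamma (N + d + 1) / Real.Gamma (N + 1)) ^ 2 /
          (Real.Gamma (2 * N + d + 1) / Real.Gamma (2 * N + 1))) := by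
  intro N
  have hN : 0 < N := sum_add_pos hu hv
  have gamma_pos {z : ℝ} (hz : 0 < z) : 0 < Real.Gamma (z + 1) :=
    Real.Gamma_pos_of_pos (add_pos hz one_pos)
  have four_rpow : (4 : ℝ) ^ N = (∏ i, (4 : ℝ) ^ u i) * 4 ^ v := by
    rw [Real.rpow_add four_pos, Real.rpow_sum_of_pos four_pos]
  have sum_two : ∑ i, (2 * u i + 1) + (2 * v + 1) = 2 * N + d + 1 := by
    simp only [Finset.sum_add_distrib, ← Finset.mul_sum, Finset.sum_const, Finset.card_univ,
      Fintype.card_fin, nsmul_one, N]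
    ring
  have sum_one : ∑ i, (u i + 1) + (v + 1) = N + d + 1 := by
    simp only [Finset.sum_add_distrib, Finset.sum_const, Finset.card_univ, Fintype.card_fin,
      nsmul_one, N]
    ring
  have binom_prod : (∏ i, Real.Gamma (2 * u i + 1)) / (∏ i, Real.Gamma (u i + 1)) ^ 2 =
      (∏ i, (4 : ℝ) ^ u i) / (∏ i, √(u i)) * ∏ i, scaledCentralBinom (u i) := by
    rw [← Finset.prod_pow, ← Finset.prod_div_distrib, ← Finset.prod_div_distrib,
      ← Finset.prod_mul_distrib]
    exact Finset.prod_congr rfl fun i _ => Gamma_two_mul_add_one_div_sq (hu i)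
  calc _ = (∏ i, Real.Gamma (2 * u i + 1)) / (∏ i, Real.Gamma (u i + 1)) ^ 2 *
        (Real.Gamma (2 * v + 1) / Real.Gamma (v + 1) ^ 2) /
          (Real.Gamma (2 * N + 1) / Real.Gamma (N + 1) ^ 2) *
        ((Real.Gamma (N + d + 1) / Real.Gamma (N + 1)) ^ 2 /
          (Real.Gamma (2 * N + d + 1) / Real.Gamma (2 * N + 1))) := by
        have := gamma_pos hN
        have := gamma_pos (mul_pos two_pos hN)
        rw [dirichletBeta, dirichletBeta, sum_two, sum_one]
        field_simp
    _ = _ := by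
        rw [binom_prod, Gamma_two_mul_add_one_div_sq hv, Gamma_two_mul_add_one_div_sq hN, four_rpow]
        have : 0 < ∏ i, (4 : ℝ) ^ u i := Finset.prod_pos fun i _ => Real.rpow_pos_of_pos four_pos _
        field_simp

/-- The factor `A_b(s)` in `K_b² = A_b(s) K_{b/2}`. -/
noncomputable def kernelSqConst (b : ℝ) (s : Fin d → ℝ) : ℝ :=
  dirichletBeta (fun i => 2 * (s i / b) + 1) (2 * ((1 - l1Norm s) / b) + 1) /
    dirichletBeta (fun i => s i / b + 1) ((1 - l1Norm s) / b + 1) ^ 2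

section KernelSquare

variable {s : Fin d → ℝ} {b : ℝ}

lemma kernel_sq (hs : s ∈ simplex d) (hb : 0 < b) {x : Fin d → ℝ} (hx : x ∈ simplex d) :
    kernel b s x ^ 2 = kernelSqConst b s * kernel (b / 2) s x := by
  have div_half (a : ℝ) : a / (b / 2) + 1 = a / b + 1 + a / b := by field_simp; ring
  have two_mul_add (a : ℝ) : 2 * a + 1 = a + 1 + a := by ring
  have hα := one_le_div_add_one hs hb
  have hβ := one_le_one_sub_div_add_one hs hb
  have density_eq : kernel b s x =
      (dirichletBeta (fun i => s i / b + 1) ((1 - l1Norm s) / b + 1))⁻¹ *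
      ((1 - l1Norm x) ^ ((1 - l1Norm s) / b) * ∏ i, x i ^ (s i / b)) := by
    simp only [kernel, dirichletDensity_eq (fun i => zero_le_one.trans (hα i)),
      add_sub_cancel_right]
  have shift := dirichletDensity_mul_rpow hα hβ (γ := fun i => s i / b) (δ := (1 - l1Norm s) / b)
    (fun i => sub_nonneg.1 (by simpa using hα i)) (by simpa using hβ) hx
  calc kernel b s x ^ 2 = (dirichletBeta (fun i => s i / b + 1) ((1 - l1Norm s) / b + 1))⁻¹ *
        (kernel b s x * ((1 - l1Norm x) ^ ((1 - l1Norm s) / b) * ∏ i, x i ^ (s i / b))) := by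
        rw [sq]
        nth_rw 2 [density_eq]
        ring
    _ = _ := by
        rw [kernel, shift, kernelSqConst, kernel]
        simp only [div_half, two_mul_add, Pi.add_def]
        field_simp

lemma psi_eq (hs : s ∈ simplexInterior d) :
    psi s = ((∏ i, √(s i)) * √(1 - l1Norm s))⁻¹ * ((√Real.pi)⁻¹ ^ d * 2⁻¹ ^ d) := by
  have hs0 (i) : 0 ≤ s i := (hs.1 i).1.le
  have hs1 : 0 ≤ 1 - l1Norm s := sub_nonneg.2 hs.2.le
  have hprod : 0 ≤ ∏ i, s i := Finset.prod_nonneg fun i _ => hs0 i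
  have sqrt_four_pi : √(4 * Real.pi) = 2 * √Real.pi := by
    rw [Real.sqrt_mul four_pos.le, show (4 : ℝ) = 2 ^ 2 by norm_num, Real.sqrt_sq two_pos.le]
  rw [psi, Real.rpow_neg (by positivity), Real.mul_rpow (by positivity) hprod,
    Real.mul_rpow (by positivity) hs1, ← Real.rpow_pow_comm (by positivity),
    ← Real.finsetProd_rpow _ _ fun i _ => hs0 i]
  simp only [← Real.sqrt_eq_rpow, sqrt_four_pi]
  rw [← mul_pow, ← mul_inv, inv_pow, ← mul_inv]
  ring

lemma sqrt_pow_mul_kernelSqConst (hs : s ∈ simplexInterior d) (hb : 0 < b) :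
    √b ^ d * kernelSqConst b s = ((∏ i, √(s i)) * √(1 - l1Norm s))⁻¹ *
      ((∏ i, scaledCentralBinom (s i / b)) * scaledCentralBinom ((1 - l1Norm s) / b) /
        scaledCentralBinom b⁻¹ *
        (2⁻¹ ^ d * ((Real.Gamma (b⁻¹ + d + 1) / Real.Gamma (b⁻¹ + 1) / b⁻¹ ^ d) ^ 2 /
          (Real.Gamma (2 * b⁻¹ + d + 1) / Real.Gamma (2 * b⁻¹ + 1) / (2 * b⁻¹) ^ d)))) := by
  have hs0 (i) : 0 < s i := (hs.1 i).1
  have hs1 : 0 < 1 - l1Norm s := sub_pos.2 hs.2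
  have sum_eq : ∑ i, s i / b + (1 - l1Norm s) / b = b⁻¹ := by
    rw [← Finset.sum_div, l1Norm_of_nonneg fun i => (hs0 i).le]
    ring
  have sqrt_eq : √b⁻¹ / ((∏ i, √(s i / b)) * √((1 - l1Norm s) / b)) =
      √b ^ d * ((∏ i, √(s i)) * √(1 - l1Norm s))⁻¹ := by
    have := Real.sqrt_pos.2 hs1
    have : 0 < ∏ i, √(s i) := Finset.prod_pos fun i _ => Real.sqrt_pos.2 (hs0 i)
    simp only [Real.sqrt_div' _ hb.le, Finset.prod_div_distrib, Finset.prod_const, Finset.card_univ,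
      Fintype.card_fin, Real.sqrt_inv]
    field_simp
  have sqrt_pow : √b ^ d * √b ^ d = b ^ d := by rw [← mul_pow, Real.mul_self_sqrt hb.le]
  rw [kernelSqConst, dirichletBeta_two_mul_add_one_div_sq (fun i => div_pos (hs0 i) hb)
    (div_pos hs1 hb), sum_eq, sqrt_eq, ← mul_assoc, ← mul_assoc, ← mul_assoc, sqrt_pow]
  simp only [mul_pow, inv_pow, div_pow]
  field_simp

theorem tendsto_sqrt_pow_mul_kernelSqConst (hs : s ∈ simplexInterior d) :
    Tendsto (fun b => √b ^ d * kernelSqConst b s) (𝓝[>] 0) (𝓝 (psi s)) := by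
  have binom {u : ℝ} (hu : 0 < u) :
      Tendsto (fun b => scaledCentralBinom (u / b)) (𝓝[>] 0) (𝓝 (√Real.pi)⁻¹) :=
    tendsto_scaledCentralBinom.comp (tendsto_inv_nhdsGT_zero.const_mul_atTop hu)
  have binom_ratio : Tendsto (fun b => (∏ i, scaledCentralBinom (s i / b)) *
      scaledCentralBinom ((1 - l1Norm s) / b) / scaledCentralBinom b⁻¹) (𝓝[>] 0)
      (𝓝 ((√Real.pi)⁻¹ ^ d)) := by
    have lim := ((tendsto_finsetProd Finset.univ fun i _ => binom (hs.1 i).1).mul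
      (binom (sub_pos.2 hs.2))).div (tendsto_scaledCentralBinom.comp tendsto_inv_nhdsGT_zero)
      (by positivity)
    rwa [mul_div_cancel_right₀ _ (by positivity), Finset.prod_const, Finset.card_univ,
      Fintype.card_fin] at lim
  have gamma_ratio :=
    (((tendsto_Gamma_add_nat_add_one_div d).comp tendsto_inv_nhdsGT_zero).pow 2).div
      ((tendsto_Gamma_add_nat_add_one_div d).comp
        (tendsto_inv_nhdsGT_zero.const_mul_atTop two_pos)) one_ne_zero
  rw [one_pow, div_one] at gamma_ratio
  have lim := (binom_ratio.mul (gamma_ratio.const_mul (2⁻¹ ^ d))).const_mul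
    (((∏ i, √(s i)) * √(1 - l1Norm s))⁻¹)
  rw [mul_one, ← psi_eq hs] at lim
  refine lim.congr' ?_
  filter_upwards [self_mem_nhdsWithin] with b hb
  exact (sqrt_pow_mul_kernelSqConst hs hb).symm

end KernelSquare

/-! ### Moments of the kernel under the law of an observation -/

lemma continuous_dirichletDensity {α : Fin d → ℝ} {β : ℝ} (hα : ∀ i, 1 ≤ α i) (hβ : 1 ≤ β) :
    Continuous (dirichletDensity α β) :=
  continuous_const.mul (((continuous_const.sub continuous_l1Norm).rpow_const
    fun _ => .inr (sub_nonneg.2 hβ)).mul (continuous_finsetProd _ fun i _ =>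
      (continuous_apply i).rpow_const fun _ => .inr (sub_nonneg.2 (hα i))))

section ObservationMoments

variable {s : Fin d → ℝ} {f : (Fin d → ℝ) → ℝ}

@[fun_prop]
lemma measurable_kernel (b : ℝ) (s : Fin d → ℝ) : Measurable (kernel b s) :=
  measurable_dirichletDensity _ _

lemma memLp_kernel [IsFiniteMeasure (lawOfDensity f)] (hs : s ∈ simplex d) {b : ℝ} (hb : 0 < b)
    (p : ENNReal) : MemLp (kernel b s) p (lawOfDensity f) :=
  memLp_lawOfDensity_of_continuousOn (continuous_dirichletDensity (one_le_div_add_one hs hb)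
    (one_le_one_sub_div_add_one hs hb)).continuousOn p

lemma integrable_kernel_pow [IsFiniteMeasure (lawOfDensity f)] (hs : s ∈ simplex d) {b : ℝ}
    (hb : 0 < b) (k : ℕ) : Integrable (fun x => kernel b s x ^ k) (lawOfDensity f) :=
  integrable_pow_of_memLp (memLp_kernel hs hb k) le_rfl

lemma integral_kernel_lawOfDensity (hs : s ∈ simplex d) (hf : ∀ x ∈ simplex d, 0 ≤ f x)
    (hfc : ContinuousOn f (simplex d)) {b : ℝ} (hb : 0 < b) :
    ∫ x, kernel b s x ∂lawOfDensity f = ∫ x, f x ∂lawOfDensity (kernel b s) :=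
  integral_lawOfDensity_comm hf (hfc.aemeasurable measurableSet_simplex)
    (fun _ hx => dirichletDensity_nonneg (fun i => one_pos.trans_le (one_le_div_add_one hs hb i))
      (one_pos.trans_le (one_le_one_sub_div_add_one hs hb)) hx)
    (measurable_kernel b s).aemeasurable

lemma tendsto_integral_kernel_lawOfDensity (hs : s ∈ simplex d) (hf : ∀ x ∈ simplex d, 0 ≤ f x)
    (hfc : ContinuousOn f (simplex d)) :
    Tendsto (fun b => ∫ x, kernel b s x ∂lawOfDensity f) (𝓝[>] 0) (𝓝 (f s)) := by
  refine (tendsto_integral_kernel hs hfc).congr' ?_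
  filter_upwards [self_mem_nhdsWithin] with b hb
  exact (integral_kernel_lawOfDensity hs hf hfc hb).symm

lemma integral_kernel_sq_lawOfDensity (hs : s ∈ simplex d) {b : ℝ} (hb : 0 < b) :
    ∫ x, kernel b s x ^ 2 ∂lawOfDensity f =
      kernelSqConst b s * ∫ x, kernel (b / 2) s x ∂lawOfDensity f := by
  rw [← integral_const_mul]
  exact integral_congr_ae ((ae_mem_simplex f).mono fun x hx => kernel_sq hs hb hx)

lemma integral_kernel_pow_four_lawOfDensity (hs : s ∈ simplex d) {b : ℝ} (hb : 0 < b) :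
    ∫ x, kernel b s x ^ 4 ∂lawOfDensity f =
      kernelSqConst b s ^ 2 * ∫ x, kernel (b / 2) s x ^ 2 ∂lawOfDensity f := by
  rw [← integral_const_mul]
  refine integral_congr_ae ((ae_mem_simplex f).mono fun x hx => ?_)
  simp only [pow_mul _ 2 2, kernel_sq hs hb hx, mul_pow, show 4 = 2 * 2 from rfl]

lemma tendsto_div_two_nhdsGT_zero : Tendsto (fun b : ℝ => b / 2) (𝓝[>] 0) (𝓝[>] 0) := by
  have lim : Tendsto (fun b : ℝ => b / 2) (𝓝[>] 0) (𝓝 (0 / 2)) :=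
    (tendsto_id.mono_left nhdsWithin_le_nhds).div_const 2
  rw [zero_div] at lim
  exact tendsto_nhdsWithin_iff.2
    ⟨lim, eventually_mem_nhdsWithin.mono fun _ hb => Set.mem_Ioi.2 (half_pos hb)⟩

lemma tendsto_sqrt_pow_mul_integral_kernel_sq (hs : s ∈ simplexInterior d)
    (hf : ∀ x ∈ simplex d, 0 ≤ f x) (hfc : ContinuousOn f (simplex d)) :
    Tendsto (fun b => √b ^ d * ∫ x, kernel b s x ^ 2 ∂lawOfDensity f) (𝓝[>] 0)
      (𝓝 (psi s * f s)) := by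
  have hs' := simplexInterior_subset hs
  refine ((tendsto_sqrt_pow_mul_kernelSqConst hs).mul ((tendsto_integral_kernel_lawOfDensity hs' hf
    hfc).comp tendsto_div_two_nhdsGT_zero)).congr' ?_
  filter_upwards [self_mem_nhdsWithin] with b hb
  rw [integral_kernel_sq_lawOfDensity hs' hb, mul_assoc, Function.comp]

lemma tendsto_sqrt_pow_cube_mul_integral_kernel_pow_four (hs : s ∈ simplexInterior d)
    (hf : ∀ x ∈ simplex d, 0 ≤ f x) (hfc : ContinuousOn f (simplex d)) :
    Tendsto (fun b => (√b ^ d) ^ 3 * ∫ x, kernel b s x ^ 4 ∂lawOfDensity f) (𝓝[>] 0)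
      (𝓝 (psi s ^ 2 * (√2 ^ d * (psi s * f s)))) := by
  refine (((tendsto_sqrt_pow_mul_kernelSqConst hs).pow 2).mul
    (((tendsto_sqrt_pow_mul_integral_kernel_sq hs hf hfc).comp
      tendsto_div_two_nhdsGT_zero).const_mul (√2 ^ d))).congr' ?_
  filter_upwards [self_mem_nhdsWithin] with b hb
  have sqrt_half : √2 ^ d * √(b / 2) ^ d = √b ^ d := by
    rw [← mul_pow, ← Real.sqrt_mul two_pos.le, mul_div_cancel₀ _ two_ne_zero]
  rw [integral_kernel_pow_four_lawOfDensity (simplexInterior_subset hs) hb, Function.comp,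
    ← mul_assoc (√2 ^ d), sqrt_half]
  ring

end ObservationMoments

/-! ### Asymptotic normality of the estimator -/

lemma tendstoInDistribution_congr' {ι Ω E : Type*} [MeasurableSpace Ω] {P : Measure Ω}
    [IsProbabilityMeasure P] [TopologicalSpace E] [MeasurableSpace E] [OpensMeasurableSpace E]
    {Ω' : Type*} [MeasurableSpace Ω'] {P' : Measure Ω'} [IsProbabilityMeasure P']
    {l : Filter ι} {Y Y' : ι → Ω → E} {Z : Ω' → E}
    (hY : TendstoInDistribution Y l Z (fun _ => P) P') (hYY' : Y =ᶠ[l] Y')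
    (hY' : ∀ i, AEMeasurable (Y' i) P) : TendstoInDistribution Y' l Z (fun _ => P) P' where
  forall_aemeasurable := hY'
  aemeasurable_limit := hY.aemeasurable_limit
  tendsto := hY.tendsto.congr' (hYY'.mono fun _ hi => Subtype.ext (congrArg P.map hi))

lemma tendstoInDistribution_sum_comp_of_iid {Ω E : Type*} [MeasurableSpace Ω] {P : Measure Ω}
    [IsProbabilityMeasure P] [MeasurableSpace E] {X : ℕ → Ω → E} {μ : Measure E}
    (hindep : iIndepFun X P) (hlaw : ∀ i, HasLaw (X i) μ P) {T : ℕ → E → ℝ}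
    (hT : ∀ n, Measurable (T n)) (h4 : ∀ᶠ n in atTop, MemLp (T n) (4 : ℕ) μ) {m v : ℝ}
    (hm : Tendsto (fun n : ℕ => n * ∫ x, T n x ∂μ) atTop (𝓝 m))
    (hv : Tendsto (fun n : ℕ => n * ∫ x, T n x ^ 2 ∂μ) atTop (𝓝 v))
    (hk : Tendsto (fun n : ℕ => n * ∫ x, T n x ^ 4 ∂μ) atTop (𝓝 0)) :
    TendstoInDistribution (fun n ω => ∑ i ∈ Finset.range n, T n (X i ω)) atTop (id : ℝ → ℝ)
      (fun _ => P) (gaussianReal m v.toNNReal) := by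
  have moment (n k : ℕ) : ∫ y, y ^ k ∂μ.map (T n) = ∫ x, T n x ^ k ∂μ :=
    integral_map (hT n).aemeasurable (continuous_pow k).aestronglyMeasurable
  exact tendstoInDistribution_sum_of_iid_rows (fun n => hindep.comp (fun _ => T n) fun _ => hT n)
    (fun n i => ⟨((hT n).comp_aemeasurable (hlaw i).aemeasurable), by
      rw [← (hlaw i).map_eq, AEMeasurable.map_map_of_aemeasurable (hT n).aemeasurable
        (hlaw i).aemeasurable]⟩)
    (h4.mono fun n hn => (memLp_map_measure_iff aestronglyMeasurable_id (hT n).aemeasurable).2 hn)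
    (hm.congr fun n => by simpa only [pow_one] using congrArg ((n : ℝ) * ·) (moment n 1).symm)
    (hv.congr fun n => by rw [moment]) (hk.congr fun n => by rw [moment])

section Estimator

variable {s : Fin d → ℝ} {f : (Fin d → ℝ) → ℝ}

lemma tendsto_sqrt_pow_nhdsGT_zero (hd : d ≠ 0) :
    Tendsto (fun b : ℝ => √b ^ d) (𝓝[>] 0) (𝓝 0) := by
  have cont : Continuous fun b : ℝ => √b ^ d := by fun_prop
  simpa [hd] using (cont.tendsto 0).mono_left (nhdsWithin_le_nhds (s := Set.Ioi 0))

lemma tendsto_mul_integral_scaled_kernel_sq [IsProbabilityMeasure (lawOfDensity f)] (hd : d ≠ 0)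
    (hs : s ∈ simplexInterior d) (hf : ∀ x ∈ simplex d, 0 ≤ f x)
    (hfc : ContinuousOn f (simplex d)) {b r c : ℕ → ℝ} {c₀ τ : ℝ} (hb : Tendsto b atTop (𝓝[>] 0))
    (hc : Tendsto c atTop (𝓝 c₀))
    (hr : Tendsto (fun n : ℕ => r n ^ 2 / (n * √(b n) ^ d)) atTop (𝓝 τ)) :
    Tendsto (fun n : ℕ => n * ∫ x, (r n / n * (kernel (b n) s x - c n)) ^ 2 ∂lawOfDensity f) atTop
      (𝓝 (τ * (psi s * f s))) := by
  have hs' := simplexInterior_subset hs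
  have lim_sq := (tendsto_sqrt_pow_mul_integral_kernel_sq hs hf hfc).comp hb
  have lim_mean := (tendsto_integral_kernel_lawOfDensity hs' hf hfc).comp hb
  have lim_sqrt := (tendsto_sqrt_pow_nhdsGT_zero hd).comp hb
  have lim := hr.mul (lim_sq.add (lim_sqrt.mul ((hc.pow 2).sub ((hc.const_mul 2).mul lim_mean))))
  rw [zero_mul, add_zero] at lim
  refine lim.congr' ?_
  filter_upwards [hb.eventually eventually_mem_nhdsWithin, eventually_ne_atTop 0] with n hbn hn
  have hW : √(b n) ^ d ≠ 0 := (pow_pos (Real.sqrt_pos.2 hbn) d).ne'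
  have i1 : Integrable (kernel (b n) s) (lawOfDensity f) :=
    (memLp_kernel hs' hbn 1).integrable le_rfl
  have expand : ∫ x, (kernel (b n) s x - c n) ^ 2 ∂lawOfDensity f =
      (∫ x, kernel (b n) s x ^ 2 ∂lawOfDensity f) +
        (c n ^ 2 - 2 * c n * ∫ x, kernel (b n) s x ∂lawOfDensity f) := by
    have square (x : Fin d → ℝ) : (kernel (b n) s x - c n) ^ 2 =
        kernel (b n) s x ^ 2 + (c n ^ 2 - 2 * c n * kernel (b n) s x) := by ring
    simp only [square]
    rw [integral_add (integrable_kernel_pow hs' hbn 2)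
      (by exact (integrable_const _).sub (i1.const_mul _)),
      integral_sub (integrable_const _) (i1.const_mul _), integral_const_mul, integral_const,
      probReal_univ, one_smul]
  simp only [mul_pow, integral_const_mul, expand, Function.comp_apply]
  field_simp

lemma integral_sub_const_pow_four_le {E : Type*} [MeasurableSpace E] {μ : Measure E}
    [IsProbabilityMeasure μ] {g : E → ℝ} (hg : Integrable (fun x => g x ^ 4) μ) (c : ℝ) :
    ∫ x, (g x - c) ^ 4 ∂μ ≤ 8 * ((∫ x, g x ^ 4 ∂μ) + c ^ 4) := by
  calc ∫ x, (g x - c) ^ 4 ∂μ ≤ ∫ x, 8 * (g x ^ 4 + c ^ 4) ∂μ := by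
        refine integral_mono_of_nonneg (ae_of_all _ fun x => by positivity)
          ((hg.add (integrable_const _)).const_mul _) (ae_of_all _ fun x => ?_)
        have h := (show Even 4 by decide).add_pow_le (a := g x) (b := -c)
        rw [(show Even 4 by decide).neg_pow, ← sub_eq_add_neg] at h
        exact h.trans_eq (by norm_num)
    _ = 8 * ((∫ x, g x ^ 4 ∂μ) + c ^ 4) := by
        rw [integral_const_mul, integral_add hg (integrable_const _), integral_const,
          probReal_univ, one_smul]

lemma tendsto_mul_integral_scaled_kernel_pow_four [IsProbabilityMeasure (lawOfDensity f)]
    (hd : d ≠ 0) (hs : s ∈ simplexInterior d) (hf : ∀ x ∈ simplex d, 0 ≤ f x)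
    (hfc : ContinuousOn f (simplex d)) {b r c : ℕ → ℝ} {c₀ τ : ℝ} (hb : Tendsto b atTop (𝓝[>] 0))
    (hnb : Tendsto (fun n : ℕ => n * √(b n) ^ d) atTop atTop) (hc : Tendsto c atTop (𝓝 c₀))
    (hr : Tendsto (fun n : ℕ => r n ^ 2 / (n * √(b n) ^ d)) atTop (𝓝 τ)) :
    Tendsto (fun n : ℕ => n * ∫ x, (r n / n * (kernel (b n) s x - c n)) ^ 4 ∂lawOfDensity f) atTop
      (𝓝 0) := by
  have lim_four := (tendsto_sqrt_pow_cube_mul_integral_kernel_pow_four hs hf hfc).comp hb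
  have lim_sqrt := (tendsto_sqrt_pow_nhdsGT_zero hd).comp hb
  have lim := (hr.pow 2).mul ((tendsto_inv_atTop_zero.comp hnb).mul
    ((lim_four.add ((lim_sqrt.pow 3).mul (hc.pow 4))).const_mul 8))
  rw [zero_mul, mul_zero] at lim
  refine squeeze_zero' (.of_forall fun n => by positivity) ?_ lim
  filter_upwards [hb.eventually eventually_mem_nhdsWithin, eventually_ne_atTop 0] with n hbn hn
  have hW : √(b n) ^ d ≠ 0 := (pow_pos (Real.sqrt_pos.2 hbn) d).ne'
  simp only [mul_pow, integral_const_mul, Function.comp_apply]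
  calc n * ((r n / n) ^ 4 * ∫ x, (kernel (b n) s x - c n) ^ 4 ∂lawOfDensity f)
      ≤ n * ((r n / n) ^ 4 * (8 * ((∫ x, kernel (b n) s x ^ 4 ∂lawOfDensity f) + c n ^ 4))) := by
        gcongr
        exact integral_sub_const_pow_four_le
          (integrable_kernel_pow (simplexInterior_subset hs) hbn 4) _
    _ = _ := by field_simp

variable {Ω : Type*} [MeasurableSpace Ω] {P : Measure Ω} {X : ℕ → Ω → Fin d → ℝ}

lemma integral_estimator [IsFiniteMeasure (lawOfDensity f)] (hs : s ∈ simplex d)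
    (hlaw : ∀ i, HasLaw (X i) (lawOfDensity f) P) {n : ℕ} (hn : n ≠ 0) {b : ℝ} (hb : 0 < b) :
    ∫ ω, estimator X n b s ω ∂P = ∫ x, kernel b s x ∂lawOfDensity f := by
  have integral_comp (i : ℕ) : ∫ ω, kernel b s (X i ω) ∂P = ∫ x, kernel b s x ∂lawOfDensity f :=
    (hlaw i).integral_comp (measurable_kernel b s).aestronglyMeasurable
  have integrable_comp (i : ℕ) : Integrable (fun ω => kernel b s (X i ω)) P := by
    refine Integrable.comp_aemeasurable ?_ (hlaw i).aemeasurable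
    rw [(hlaw i).map_eq]
    exact (memLp_kernel hs hb 1).integrable le_rfl
  unfold estimator
  rw [integral_const_mul, integral_finsetSum _ fun i _ => integrable_comp i]
  simp only [integral_comp, Finset.sum_const, Finset.card_range, nsmul_eq_mul]
  field_simp

lemma aemeasurable_estimator (hX : ∀ i, AEMeasurable (X i) P) (n : ℕ) (b : ℝ) (s : Fin d → ℝ) :
    AEMeasurable (estimator X n b s) P :=
  (Finset.aemeasurable_fun_sum _ fun i _ =>
    (measurable_kernel b s).comp_aemeasurable (hX i)).const_mul _

theorem tendstoInDistribution_estimator [IsProbabilityMeasure P] (hd : d ≠ 0)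
    (hs : s ∈ simplexInterior d) (hf : ∀ x ∈ simplex d, 0 ≤ f x) (hfc : ContinuousOn f (simplex d))
    (hindep : iIndepFun X P) (hlaw : ∀ i, HasLaw (X i) (lawOfDensity f) P)
    {b r c : ℕ → ℝ} {c₀ τ m : ℝ} (hb : Tendsto b atTop (𝓝[>] 0))
    (hnb : Tendsto (fun n : ℕ => n * √(b n) ^ d) atTop atTop) (hc : Tendsto c atTop (𝓝 c₀))
    (hr : Tendsto (fun n : ℕ => r n ^ 2 / (n * √(b n) ^ d)) atTop (𝓝 τ))
    (hm : Tendsto (fun n => r n * (∫ x, kernel (b n) s x ∂lawOfDensity f - c n)) atTop (𝓝 m)) :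
    TendstoInDistribution (fun n ω => r n * (estimator X n (b n) s ω - c n)) atTop
      (id : ℝ → ℝ) (fun _ => P) (gaussianReal m (τ * (psi s * f s)).toNNReal) := by
  have : IsProbabilityMeasure (lawOfDensity f) := (hlaw 0).isProbabilityMeasure_iff.1 inferInstance
  have hs' := simplexInterior_subset hs
  have pos : ∀ᶠ n : ℕ in atTop, n ≠ 0 ∧ 0 < b n :=
    (eventually_ne_atTop 0).and (hb.eventually eventually_mem_nhdsWithin)
  refine tendstoInDistribution_congr' (tendstoInDistribution_sum_comp_of_iid hindep hlaw
    (T := fun n x => r n / n * (kernel (b n) s x - c n)) (fun n => by fun_prop) ?_ ?_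
    (tendsto_mul_integral_scaled_kernel_sq hd hs hf hfc hb hc hr)
    (tendsto_mul_integral_scaled_kernel_pow_four hd hs hf hfc hb hnb hc hr)) ?_
    fun n => ((aemeasurable_estimator (fun i => (hlaw i).aemeasurable) n _ s).sub_const
      _).const_mul _
  · filter_upwards [pos] with n hn
    exact ((memLp_kernel hs' hn.2 _).sub (memLp_const _)).const_mul _
  · refine hm.congr' ?_
    filter_upwards [pos] with n ⟨hn, hbn⟩
    rw [integral_const_mul, integral_sub ((memLp_kernel hs' hbn 1).integrable le_rfl)
      (integrable_const _), integral_const, probReal_univ, one_smul]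
    field_simp
  · filter_upwards [pos] with n ⟨hn, _⟩
    ext ω
    simp only [estimator, ← Finset.mul_sum, Finset.sum_sub_distrib, Finset.sum_const,
      Finset.card_range, nsmul_eq_mul]
    field_simp

end Estimator

/-! ### Bandwidths and bias -/

lemma sqrt_pow_eq_rpow {b : ℝ} (hb : 0 ≤ b) (d : ℕ) : √b ^ d = b ^ ((d : ℝ) / 2) := by
  rw [Real.sqrt_eq_rpow, ← Real.rpow_mul_natCast hb]
  ring_nf

lemma rpow_half_mul_rpow_quarter_sq {x b : ℝ} (hx : 0 ≤ x) (hb : 0 ≤ b) (d : ℕ) :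
    (x ^ (1 / 2 : ℝ) * b ^ ((d : ℝ) / 4)) ^ 2 = x * √b ^ d := by
  rw [mul_pow, ← Real.rpow_mul_natCast hx, ← Real.rpow_mul_natCast hb, sqrt_pow_eq_rpow hb,
    show (1 / 2 : ℝ) * (2 : ℕ) = 1 by norm_num, Real.rpow_one]
  congr 2
  push_cast
  ring

lemma rpow_two_div_sq_div {x b : ℝ} (hx : 0 < x) (hb : 0 < b) (d : ℕ) :
    (x ^ (2 / ((d : ℝ) + 4))) ^ 2 / (x * √b ^ d) =
      (x ^ (2 / ((d : ℝ) + 4)) * b) ^ (-(d : ℝ) / 2) := by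
  have hd : (d : ℝ) + 4 ≠ 0 := by positivity
  rw [Real.mul_rpow (by positivity) hb.le, ← Real.rpow_mul_natCast hx.le, ← Real.rpow_mul hx.le,
    sqrt_pow_eq_rpow hb.le, neg_div, Real.rpow_neg hb.le, div_mul_eq_div_div,
    ← Real.rpow_sub_one hx.ne', div_eq_mul_inv]
  congr 2
  push_cast
  field_simp
  ring

section Bandwidth

variable {b : ℕ → ℝ}

lemma tendsto_natCast_mul_sqrt_pow_atTop (hb : ∀ᶠ n in atTop, 0 ≤ b n)
    (h : Tendsto (fun n : ℕ => (n : ℝ) ^ (1 / 2 : ℝ) * b n ^ ((d : ℝ) / 4)) atTop atTop) :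
    Tendsto (fun n : ℕ => n * √(b n) ^ d) atTop atTop := by
  refine ((tendsto_pow_atTop two_ne_zero).comp h).congr' ?_
  filter_upwards [hb] with n hn using rpow_half_mul_rpow_quarter_sq n.cast_nonneg hn d

lemma tendsto_rpow_half_mul_rpow_quarter_sq_div (hb : ∀ᶠ n in atTop, 0 < b n) :
    Tendsto (fun n : ℕ => ((n : ℝ) ^ (1 / 2 : ℝ) * b n ^ ((d : ℝ) / 4)) ^ 2 / (n * √(b n) ^ d))
      atTop (𝓝 1) := by
  refine tendsto_const_nhds.congr' ?_
  filter_upwards [hb, eventually_gt_atTop 0] with n hbn hn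
  rw [rpow_half_mul_rpow_quarter_sq n.cast_nonneg hbn.le, div_self]
  exact (mul_pos (Nat.cast_pos.2 hn) (pow_pos (Real.sqrt_pos.2 hbn) d)).ne'

lemma tendsto_zero_of_rate_mul {a : ℕ → ℝ} {lam : ℝ} (ha : Tendsto a atTop atTop)
    (h : Tendsto (fun n => a n * b n) atTop (𝓝 lam)) : Tendsto b atTop (𝓝 0) := by
  have lim := h.mul (tendsto_inv_atTop_zero.comp ha)
  rw [mul_zero] at lim
  refine lim.congr' ?_
  filter_upwards [ha.eventually_ne_atTop 0] with n hn
  rw [Function.comp_apply, mul_right_comm, mul_inv_cancel₀ hn, one_mul]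

lemma tendsto_rpow_two_div_atTop :
    Tendsto (fun n : ℕ => (n : ℝ) ^ (2 / ((d : ℝ) + 4))) atTop atTop :=
  (tendsto_rpow_atTop (by positivity)).comp tendsto_natCast_atTop_atTop

lemma tendsto_rpow_two_div_sq_div (hb : ∀ᶠ n in atTop, 0 < b n) {lam : ℝ} (hlam : lam ≠ 0)
    (h : Tendsto (fun n : ℕ => (n : ℝ) ^ (2 / ((d : ℝ) + 4)) * b n) atTop (𝓝 lam)) :
    Tendsto (fun n : ℕ => ((n : ℝ) ^ (2 / ((d : ℝ) + 4))) ^ 2 / (n * √(b n) ^ d)) atTop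
      (𝓝 (lam ^ (-(d : ℝ) / 2))) := by
  refine (h.rpow_const (.inl hlam)).congr' ?_
  filter_upwards [hb, eventually_gt_atTop 0] with n hbn hn
  exact (rpow_two_div_sq_div (Nat.cast_pos.2 hn) hbn d).symm

lemma tendsto_atTop_of_sq_div {a w : ℕ → ℝ} {τ : ℝ} (hτ : 0 < τ) (ha : Tendsto a atTop atTop)
    (h : Tendsto (fun n => a n ^ 2 / w n) atTop (𝓝 τ)) : Tendsto w atTop atTop := by
  refine (((tendsto_pow_atTop two_ne_zero).comp ha).atTop_mul_pos (inv_pos.2 hτ)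
    (h.inv₀ hτ.ne')).congr' ?_
  filter_upwards [ha.eventually_ne_atTop 0] with n hn
  rw [Function.comp_apply, inv_div, mul_div_cancel₀ _ (pow_ne_zero 2 hn)]

variable {s : Fin d → ℝ} {f : (Fin d → ℝ) → ℝ} {a : ℕ → ℝ}

lemma tendsto_mul_integral_kernel_sub_zero (hs : s ∈ simplex d) (hf : ∀ x ∈ simplex d, 0 ≤ f x)
    (hfc : ContinuousOn f (simplex d))
    (hfs : (fun x => f x - f s) =O[𝓝[simplex d] s] fun x => x - s) (hb : Tendsto b atTop (𝓝[>] 0))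
    (h : Tendsto (fun n => a n * √(b n)) atTop (𝓝 0)) :
    Tendsto (fun n => a n * (∫ x, kernel (b n) s x ∂lawOfDensity f - f s)) atTop (𝓝 0) := by
  refine (((Asymptotics.isBigO_refl a atTop).mul ((isBigO_integral_kernel_sub hs hfc
    hfs).comp_tendsto hb)).trans_tendsto h).congr' ?_
  filter_upwards [hb.eventually eventually_mem_nhdsWithin] with n hbn
  rw [integral_kernel_lawOfDensity hs hf hfc hbn, Function.comp_apply]

lemma tendsto_mul_integral_kernel_sub_biasTerm (hs : s ∈ simplexInterior d)
    (hf : ∀ x ∈ simplex d, 0 ≤ f x) (hfc : ContinuousOn f (simplex d)) (hf2 : ContDiffAt ℝ 2 f s)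
    (hb : Tendsto b atTop (𝓝[>] 0)) {lam : ℝ} (h : Tendsto (fun n => a n * b n) atTop (𝓝 lam)) :
    Tendsto (fun n => a n * (∫ x, kernel (b n) s x ∂lawOfDensity f - f s)) atTop
      (𝓝 (lam * biasTerm f s)) := by
  refine (h.mul ((tendsto_inv_mul_integral_kernel_sub hs hfc hf2).comp hb)).congr' ?_
  filter_upwards [hb.eventually eventually_mem_nhdsWithin] with n hbn
  rw [integral_kernel_lawOfDensity (simplexInterior_subset hs) hf hfc hbn, Function.comp_apply,
    mul_assoc, mul_inv_cancel_left₀ (Set.mem_Ioi.1 hbn).ne']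

end Bandwidth

section CLT

variable {s : Fin d → ℝ} {f : (Fin d → ℝ) → ℝ} {Ω : Type*} [MeasurableSpace Ω] {P : Measure Ω}
  {X : ℕ → Ω → Fin d → ℝ} {b : ℕ → ℝ}

lemma eventually_integral_estimator [IsFiniteMeasure (lawOfDensity f)] (hs : s ∈ simplex d)
    (hlaw : ∀ i, HasLaw (X i) (lawOfDensity f) P) (hb : ∀ᶠ n in atTop, 0 < b n) :
    ∀ᶠ n in atTop, ∫ ω, estimator X n (b n) s ω ∂P = ∫ x, kernel (b n) s x ∂lawOfDensity f := by
  filter_upwards [hb, eventually_ne_atTop 0] with n hbn hn using integral_estimator hs hlaw hn hbn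

theorem tendstoInDistribution_rpow_half_mul_estimator_sub [IsProbabilityMeasure P] (hd : d ≠ 0)
    (hs : s ∈ simplexInterior d) (hf : ∀ x ∈ simplex d, 0 ≤ f x) (hfc : ContinuousOn f (simplex d))
    (hindep : iIndepFun X P) (hlaw : ∀ i, HasLaw (X i) (lawOfDensity f) P)
    (hb : Tendsto b atTop (𝓝[>] 0))
    (hrate : Tendsto (fun n : ℕ => (n : ℝ) ^ (1 / 2 : ℝ) * b n ^ ((d : ℝ) / 4)) atTop atTop)
    {c : ℕ → ℝ} {c₀ m : ℝ} (hc : Tendsto c atTop (𝓝 c₀))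
    (hm : Tendsto (fun n : ℕ => (n : ℝ) ^ (1 / 2 : ℝ) * b n ^ ((d : ℝ) / 4) *
      (∫ x, kernel (b n) s x ∂lawOfDensity f - c n)) atTop (𝓝 m)) :
    TendstoInDistribution (fun (n : ℕ) ω => (n : ℝ) ^ (1 / 2 : ℝ) * b n ^ ((d : ℝ) / 4) *
        (estimator X n (b n) s ω - c n))
      atTop (id : ℝ → ℝ) (fun _ => P) (gaussianReal m (psi s * f s).toNNReal) := by
  have pos : ∀ᶠ n in atTop, 0 < b n := hb.eventually eventually_mem_nhdsWithin
  simpa only [one_mul] using tendstoInDistribution_estimator hd hs hf hfc hindep hlaw hb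
    (tendsto_natCast_mul_sqrt_pow_atTop (pos.mono fun _ => le_of_lt) hrate) hc
    (tendsto_rpow_half_mul_rpow_quarter_sq_div pos) hm

end CLT

theorem mainTheorem4_general {d : ℕ} (hd : 1 ≤ d)
    {Ω : Type*} [MeasurableSpace Ω] (P : Measure Ω) [IsProbabilityMeasure P]
    (f : (Fin d → ℝ) → ℝ) (hf : ∀ x ∈ simplex d, 0 ≤ f x) (hfc : ContinuousOn f (simplex d))
    (X : ℕ → Ω → Fin d → ℝ) (hindep : iIndepFun X P)
    (hlaw : ∀ i, HasLaw (X i) (lawOfDensity f) P)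
    (b : ℕ → ℝ) (hb : ∀ᶠ n in atTop, 0 < b n)
    (s : Fin d → ℝ) (hs : s ∈ simplexInterior d) :
    (Tendsto b atTop (𝓝 0) →
      Tendsto (fun n : ℕ => (n : ℝ) ^ (1 / 2 : ℝ) * b n ^ ((d : ℝ) / 4)) atTop atTop →
        TendstoInDistribution
          (fun (n : ℕ) ω => (n : ℝ) ^ (1 / 2 : ℝ) * b n ^ ((d : ℝ) / 4) *
            (estimator X n (b n) s ω - ∫ ω', estimator X n (b n) s ω' ∂P))
          atTop (id : ℝ → ℝ) (fun _ => P) (gaussianReal 0 (psi s * f s).toNNReal) ∧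
        ((fun x => f x - f s) =O[𝓝[simplex d] s] (fun x => x - s) →
          Tendsto (fun n : ℕ => (n : ℝ) ^ (1 / 2 : ℝ) * b n ^ ((d : ℝ) / 4 + 1 / 2))
            atTop (𝓝 0) →
          TendstoInDistribution
            (fun (n : ℕ) ω => (n : ℝ) ^ (1 / 2 : ℝ) * b n ^ ((d : ℝ) / 4) *
              (estimator X n (b n) s ω - f s))
            atTop (id : ℝ → ℝ) (fun _ => P) (gaussianReal 0 (psi s * f s).toNNReal))) ∧
    (ContDiffAt ℝ 2 f s →
      ∀ lam : ℝ, 0 < lam →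
        Tendsto (fun n : ℕ => (n : ℝ) ^ (2 / ((d : ℝ) + 4)) * b n) atTop (𝓝 lam) →
        TendstoInDistribution
          (fun (n : ℕ) ω => (n : ℝ) ^ (2 / ((d : ℝ) + 4)) * (estimator X n (b n) s ω - f s))
          atTop (id : ℝ → ℝ) (fun _ => P)
          (gaussianReal (lam * biasTerm f s)
            (lam ^ (-(d : ℝ) / 2) * (psi s * f s)).toNNReal)) := by
  have hd0 : d ≠ 0 := Nat.one_le_iff_ne_zero.1 hd
  have hs' := simplexInterior_subset hs
  have : IsProbabilityMeasure (lawOfDensity f) := (hlaw 0).isProbabilityMeasure_iff.1 ‹_›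
  have bandwidth (hb0 : Tendsto b atTop (𝓝 0)) : Tendsto b atTop (𝓝[>] 0) :=
    tendsto_nhdsWithin_iff.2 ⟨hb0, hb⟩
  refine ⟨fun hb0 hrate => ⟨?_, fun hfs hbias => ?_⟩, fun hf2 lam hlam hrate => ?_⟩
  · have mean := eventually_integral_estimator hs' hlaw hb
    refine tendstoInDistribution_rpow_half_mul_estimator_sub hd0 hs hf hfc hindep hlaw
      (bandwidth hb0) hrate (((tendsto_integral_kernel_lawOfDensity hs' hf hfc).comp
        (bandwidth hb0)).congr' (mean.mono fun _ h => h.symm)) (tendsto_const_nhds.congr' ?_)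
    filter_upwards [mean] with n hn using by rw [hn, sub_self, mul_zero]
  · refine tendstoInDistribution_rpow_half_mul_estimator_sub hd0 hs hf hfc hindep hlaw
      (bandwidth hb0) hrate tendsto_const_nhds
      (tendsto_mul_integral_kernel_sub_zero hs' hf hfc hfs (bandwidth hb0) (hbias.congr' ?_))
    filter_upwards [hb] with n hn using by
      rw [Real.rpow_add hn, ← Real.sqrt_eq_rpow (b n), mul_assoc]
  · have hb0 := bandwidth (tendsto_zero_of_rate_mul tendsto_rpow_two_div_atTop hrate)
    have hr := tendsto_rpow_two_div_sq_div hb hlam.ne' hrate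
    exact tendstoInDistribution_estimator hd0 hs hf hfc hindep hlaw hb0
      (tendsto_atTop_of_sq_div (Real.rpow_pos_of_pos hlam _) tendsto_rpow_two_div_atTop hr)
      tendsto_const_nhds hr
      (tendsto_mul_integral_kernel_sub_biasTerm hs hf hfc hf2 hb0 hrate)

end DirichletKernel

open DirichletKernel in
theorem mainTheorem4 {d : ℕ} (hd : 1 ≤ d)
    {Ω : Type*} [MeasurableSpace Ω] (P : Measure Ω) [IsProbabilityMeasure P]
    (f : (Fin d → ℝ) → ℝ) (hf : ∀ x ∈ DirichletKernel.simplex d, 0 ≤ f x)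
    (X : ℕ → Ω → Fin d → ℝ) (hindep : iIndepFun X P)
    (hlaw : ∀ i, HasLaw (X i) (DirichletKernel.lawOfDensity f) P)
    (b : ℕ → ℝ) (hb : ∀ n, 1 ≤ n → 0 < b n)
    (s : Fin d → ℝ) (hs : s ∈ DirichletKernel.simplexInterior d) (hfs : 0 < f s) :
    ((∃ L, LipschitzOnWith L f (DirichletKernel.simplex d)) →
      Tendsto b atTop (𝓝 0) →
      Tendsto (fun n : ℕ => (n : ℝ) ^ (1 / 2 : ℝ) * b n ^ ((d : ℝ) / 4)) atTop atTop →
        TendstoInDistribution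
          (fun (n : ℕ) ω => (n : ℝ) ^ (1 / 2 : ℝ) * b n ^ ((d : ℝ) / 4) *
            (DirichletKernel.estimator X n (b n) s ω -
              ∫ ω', DirichletKernel.estimator X n (b n) s ω' ∂P))
          atTop (id : ℝ → ℝ) (fun _ => P)
          (gaussianReal 0 (DirichletKernel.psi s * f s).toNNReal) ∧
        (Tendsto (fun n : ℕ => (n : ℝ) ^ (1 / 2 : ℝ) * b n ^ ((d : ℝ) / 4 + 1 / 2))
            atTop (𝓝 0) →
          TendstoInDistribution
            (fun (n : ℕ) ω => (n : ℝ) ^ (1 / 2 : ℝ) * b n ^ ((d : ℝ) / 4) *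
              (DirichletKernel.estimator X n (b n) s ω - f s))
            atTop (id : ℝ → ℝ) (fun _ => P)
            (gaussianReal 0 (DirichletKernel.psi s * f s).toNNReal))) ∧
    (ContDiffOn ℝ 2 f (DirichletKernel.simplex d) →
      ∀ lam : ℝ, 0 < lam →
        Tendsto (fun n : ℕ => (n : ℝ) ^ (2 / ((d : ℝ) + 4)) * b n) atTop (𝓝 lam) →
        TendstoInDistribution
          (fun (n : ℕ) ω => (n : ℝ) ^ (2 / ((d : ℝ) + 4)) *
            (DirichletKernel.estimator X n (b n) s ω - f s))
          atTop (id : ℝ → ℝ) (fun _ => P)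
          (gaussianReal (lam * DirichletKernel.biasTerm f s)
            (lam ^ (-(d : ℝ) / 2) * (DirichletKernel.psi s * f s)).toNNReal)) := by
  have general (hfc : ContinuousOn f (simplex d)) := mainTheorem4_general hd P f hf hfc X hindep
    hlaw b (eventually_atTop.2 ⟨1, hb⟩) s hs
  refine ⟨fun ⟨L, hL⟩ hb0 hrate => ?_, fun hf2 => (general hf2.continuousOn).2
    (hf2.contDiffAt (simplex_mem_nhds hs))⟩
  have := (general hL.continuousOn).1 hb0 hrate
  exact this.imp_right fun h => h (.of_bound L (eventually_mem_nhdsWithin.mono fun x hx =>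
    hL.norm_sub_le hx (simplexInterior_subset hs)))
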